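/- A Maya diagram is a set $M\subset\mathbb{Z}$ that contains only finitely many positive integers and misses only finitely many negative integers. Put $M_-=\{-m-1 : m\notin M,\ m<0\}=\{s_1>\dots>s_p\}$ and $M_+=\{m\in M : m\ge 0\}=\{t_1>\dots>t_q\}$, let $s_M=q-p$ be the index of $M$, and for $m\in\mathbb{Z}$ let $\phi_m(M)=M\setminus\{m\}$ if $m\in M$ and $\phi_m(M)=M\cup\{m\}$ if $m\notin M$. With the Hermite polynomials $H_n(z)=(-1)^n e^{z^2}\frac{d^n}{dz^n}e^{-z^2}$ and the conjugate Hermite polynomials $\tilde H_n(z)=i^{-n}H_n(iz)$, define the Hermite pseudo-Wronskian $$H_M(z)=e^{-pz^2}\,\mathrm{Wr}\big[e^{z^2}\tilde H_{s_1},\dots,e^{z^2}\tilde H_{s_p},H_{t_q},\dots,H_{t_1}\big],$$ and the Schrödinger operator $L_M=-D_z^2+U_M$ with $$U_M(z)=z^2-2D_z^2\log H_M(z)+2s_M .$$ For $m\in\mathbb{Z}$ put $$\psi_{M,m}(z)=\exp\!\big(\tfrac12\sigma z^2\big)\,\frac{H_{\phi_m(M)}(z)}{H_M(z)},\qquad \sigma=\begin{cases}-1,&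 m\notin M,\\ +1,& m\in M.\end{cases}$$ A function $f$ that is holomorphic and not identically zero on a domain is called quasi-rational if $(\log f)'=f'/f$ is a rational function. "Eigenfunction" is meant formally, as a solution of the eigenvalue equation, with no square-integrability condition. **Proposition.** Let $M$ be a Maya diagram. 1. For every $m\in\mathbb{Z}$, the function $\psi_{M,m}$ is quasi-rational on $\{z\in\mathbb{C}: H_M(z)\ne 0\}$ and satisfies there $L_M\psi_{M,m}=(2m+1)\psi_{M,m}$. 2. Conversely, let $\Omega\subset\{z\in\mathbb{C}:H_M(z)\neq0\}$ be a nonempty connected open set, let $\lambda\in\mathbb{C}$, and let $f$ be a quasi-rational function on $\Omega$ with $L_Mf=\lambda f$. Then there are $m\in\mathbb{Z}$ and a constant $c\ne0$ such that $\lambda=2m+1$ and $f=c\,\psi_{M,m}$ on $\Omega$. -/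

import Mathlib

/-- The Hermite polynomial `H_n`, as a function on `ℂ`, by the Rodrigues formula
`H_n(z) = (-1)^n e^{z²} (d/dz)^n e^{-z²}`. -/
noncomputable def hermiteFun (n : ℕ) (z : ℂ) : ℂ :=
  (-1) ^ n * Complex.exp (z ^ 2) * iteratedDeriv n (fun w : ℂ => Complex.exp (-w ^ 2)) z

/-- The conjugate Hermite polynomial `i^{-n} H_n(i z)`. -/
noncomputable def conjHermiteFun (n : ℕ) (z : ℂ) : ℂ :=
  (Complex.I ^ n)⁻¹ * hermiteFun n (Complex.I * z)

/-- The Wronskian determinant of `f_0, …, f_{n-1}` (equal to `1` for `n = 0`). -/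
noncomputable def wronskianDet {n : ℕ} (f : Fin n → ℂ → ℂ) (z : ℂ) : ℂ :=
  Matrix.det (Matrix.of fun i j : Fin n => iteratedDeriv (j : ℕ) (f i) z)

/-- A Maya diagram: a set of integers that contains only finitely many positive integers and
misses only finitely many negative integers. -/
structure MayaDiagram where
  carrier : Set ℤ
  finite_pos : {m : ℤ | 0 < m ∧ m ∈ carrier}.Finite
  finite_neg : {m : ℤ | m < 0 ∧ m ∉ carrier}.Finite

namespace MayaDiagram

theorem finite_minusSet (M : MayaDiagram) : {n : ℕ | -(n : ℤ) - 1 ∉ M.carrier}.Finite := by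
  refine Set.Finite.of_finite_image (f := fun n : ℕ => -(n : ℤ) - 1)
    (M.finite_neg.subset ?_) ?_
  · rintro _ ⟨n, hn, rfl⟩
    exact ⟨by dsimp only; omega, hn⟩
  · intro a _ b _ h
    dsimp only at h
    omega

theorem finite_plusSet (M : MayaDiagram) : {n : ℕ | (n : ℤ) ∈ M.carrier}.Finite := by
  refine Set.Finite.of_finite_image (f := fun n : ℕ => (n : ℤ))
    ((M.finite_pos.insert 0).subset ?_) Nat.cast_injective.injOn
  rintro _ ⟨n, hn, rfl⟩
  rcases Nat.eq_zero_or_pos n with h | h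
  · left; simp [h]
  · right; exact ⟨by dsimp only; omega, hn⟩

/-- `M_- = {-m-1 : m ∉ M, m < 0}`, a finite set of natural numbers. -/
noncomputable def minus (M : MayaDiagram) : Finset ℕ := M.finite_minusSet.toFinset

/-- `M_+ = {m : m ∈ M, m ≥ 0}`, a finite set of natural numbers. -/
noncomputable def plus (M : MayaDiagram) : Finset ℕ := M.finite_plusSet.toFinset

/-- The index `s_M = q - p`, where `p = |M_-|` and `q = |M_+|`. -/
noncomputable def index (M : MayaDiagram) : ℤ := (M.plus.card : ℤ) - (M.minus.card : ℤ)

/-- `index` agrees with the description through the decreasing enumeration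
`m_1 > m_2 > ⋯` of `M` (here `m_j = e (j - 1)`): `m_j = -j + s_M` for all large `j`. -/
theorem index_spec (M : MayaDiagram) (e : ℕ → ℤ) (he : StrictAnti e)
    (hr : Set.range e = M.carrier) :
    ∃ J : ℕ, ∀ j ≥ J, e j = -((j : ℤ) + 1) + M.index := by
  classical
  obtain ⟨K, hK⟩ : ∃ K : ℕ, (∀ n ∈ M.minus, n < K) ∧ (∀ n ∈ M.plus, n < K) := by
    obtain ⟨a, ha⟩ := M.minus.bddAbove
    obtain ⟨b, hb⟩ := M.plus.bddAbove
    refine ⟨a + b + 1, fun n hn => ?_, fun n hn => ?_⟩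
    · have := ha hn; omega
    · have := hb hn; omega
  have hm : ∀ n : ℕ, n ∈ M.minus ↔ -(n : ℤ) - 1 ∉ M.carrier := by simp [minus]
  have hp : ∀ n : ℕ, n ∈ M.plus ↔ (n : ℤ) ∈ M.carrier := by simp [plus]
  have hle : ∀ j : ℕ, e j ≤ e 0 - j := by
    intro j
    induction j with
    | zero => simp
    | succ k ih =>
      have := he (Nat.lt_succ_self k)
      push_cast
      simp only [Nat.succ_eq_add_one] at this
      omega
  refine ⟨(e 0 + K + 1).toNat, fun j hj => ?_⟩
  have hjK : e j < -(K : ℤ) := by have := hle j; omega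
  obtain ⟨N, hN⟩ : ∃ N : ℕ, e j = -(N : ℤ) - 1 := ⟨(-(e j) - 1).toNat, by omega⟩
  have hNK : K ≤ N := by omega
  -- the elements of `M` above `e j`, counted in two ways
  have h1 : (Finset.range j).image e =
      M.plus.image (fun n : ℕ => (n : ℤ)) ∪
        (Finset.range N \ M.minus).image (fun n : ℕ => -(n : ℤ) - 1) := by
    ext x
    simp only [Finset.mem_image, Finset.mem_range, Finset.mem_union, Finset.mem_sdiff]
    constructor
    · rintro ⟨i, hi, rfl⟩
      have hx : e i ∈ M.carrier := hr ▸ Set.mem_range_self i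
      have hlt := he hi
      by_cases h0 : 0 ≤ e i
      · left
        refine ⟨(e i).toNat, (hp _).2 ?_, by omega⟩
        rwa [Int.toNat_of_nonneg h0]
      · right
        refine ⟨(-(e i) - 1).toNat, ⟨by omega, fun h => (hm _).1 h ?_⟩, by omega⟩
        have : -(((-(e i) - 1).toNat : ℕ) : ℤ) - 1 = e i := by omega
        rwa [this]
    · have key : ∀ y ∈ M.carrier, e j < y → ∃ i < j, e i = y := by
        intro y hy hlt
        rw [← hr] at hy
        obtain ⟨i, rfl⟩ := hy
        exact ⟨i, he.lt_iff_gt.1 hlt, rfl⟩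
      rintro (⟨n, hn, rfl⟩ | ⟨n, ⟨hn, hn'⟩, rfl⟩)
      · exact key _ ((hp n).1 hn) (by omega)
      · refine key _ ?_ (by omega)
        by_contra h
        exact hn' ((hm n).2 h)
  have h2 := congrArg Finset.card h1
  rw [Finset.card_image_of_injective _ he.injective, Finset.card_range,
    Finset.card_union_of_disjoint, Finset.card_image_of_injective _ Nat.cast_injective,
    Finset.card_image_of_injective, Finset.card_sdiff_of_subset, Finset.card_range] at h2
  · have h3 : M.minus.card ≤ N := by
      have : M.minus ⊆ Finset.range N := fun n hn =>
        Finset.mem_range.2 ((hK.1 n hn).trans_le hNK)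
      simpa using Finset.card_le_card this
    rw [index]
    omega
  · exact fun n hn => Finset.mem_range.2 ((hK.1 n hn).trans_le hNK)
  · intro a b h
    dsimp only at h
    omega
  · rw [Finset.disjoint_left]
    intro x hx hy
    simp only [Finset.mem_image] at hx hy
    obtain ⟨n, -, rfl⟩ := hx
    obtain ⟨k, -, hk⟩ := hy
    omega

/-- The elements `s_1 > s_2 > ⋯ > s_p` of `M_-` in descending order. -/
noncomputable def frobS (M : MayaDiagram) (i : Fin M.minus.card) : ℕ :=
  M.minus.orderEmbOfFin rfl i.rev

/-- The elements `t_q < ⋯ < t_2 < t_1` of `M_+` in ascending order. -/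
noncomputable def frobT (M : MayaDiagram) (j : Fin M.plus.card) : ℕ :=
  M.plus.orderEmbOfFin rfl j

/-- The Hermite pseudo-Wronskian
`H_M(z) = e^{-p z²} Wr[e^{z²} h_{s_1}, …, e^{z²} h_{s_p}, H_{t_q}, …, H_{t_1}]`,
where `h_n` is the conjugate Hermite polynomial. -/
noncomputable def pseudoWronskian (M : MayaDiagram) (z : ℂ) : ℂ :=
  Complex.exp (-(M.minus.card : ℂ) * z ^ 2) *
    wronskianDet
      (Fin.append
        (fun i : Fin M.minus.card => fun w : ℂ =>
          Complex.exp (w ^ 2) * conjHermiteFun (M.frobS i) w)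
        (fun j : Fin M.plus.card => hermiteFun (M.frobT j))) z

/-- The potential `U_M = z² - 2 (log H_M)'' + 2 s_M`, meaningful where `H_M ≠ 0`. -/
noncomputable def potential (M : MayaDiagram) (z : ℂ) : ℂ :=
  z ^ 2 - 2 * deriv (logDeriv M.pseudoWronskian) z + 2 * (M.index : ℂ)

/-- The complement of the zero set of `H_M`, that is, the set where `U_M` has no pole. -/
def regularSet (M : MayaDiagram) : Set ℂ := {z | M.pseudoWronskian z ≠ 0}

open Classical in
/-- The flip `φ_m`: remove `m` if it belongs to `M`, insert it otherwise. -/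
noncomputable def flip (M : MayaDiagram) (m : ℤ) : MayaDiagram where
  carrier := if m ∈ M.carrier then M.carrier \ {m} else M.carrier ∪ {m}
  finite_pos := by
    refine (M.finite_pos.insert m).subset ?_
    rintro k ⟨hk, hm⟩
    by_cases h : k = m
    · exact Or.inl h
    · refine Or.inr ⟨hk, ?_⟩
      split_ifs at hm
      · exact hm.1
      · exact hm.resolve_right h
  finite_neg := by
    refine (M.finite_neg.insert m).subset ?_
    rintro k ⟨hk, hm⟩
    by_cases h : k = m
    · exact Or.inl h
    · refine Or.inr ⟨hk, fun hM => hm ?_⟩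
      split_ifs
      · exact ⟨hM, h⟩
      · exact Or.inl hM

open Classical in
/-- The sign `σ`: `+1` if `m ∈ M` and `-1` if `m ∉ M`. -/
noncomputable def sign (M : MayaDiagram) (m : ℤ) : ℂ := if m ∈ M.carrier then 1 else -1

/-- `ψ_{M,m}(z) = exp(σ z² / 2) H_{φ_m(M)}(z) / H_M(z)`. -/
noncomputable def seed (M : MayaDiagram) (m : ℤ) (z : ℂ) : ℂ :=
  Complex.exp (M.sign m * z ^ 2 / 2) * ((M.flip m).pseudoWronskian z / M.pseudoWronskian z)

end MayaDiagram

/-- `f`, holomorphic and not identically zero on `Ω`, is quasi-rational: `(log f)' = f'/f` is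
(the restriction of) a rational function. -/
def IsQuasiRationalOn (f : ℂ → ℂ) (Ω : Set ℂ) : Prop :=
  DifferentiableOn ℂ f Ω ∧ (∃ z ∈ Ω, f z ≠ 0) ∧
    ∃ R : RatFunc ℂ, ∀ z ∈ Ω, f z ≠ 0 → logDeriv f z = R.eval (RingHom.id ℂ) z

/-- `f` solves `-f'' + U f = E f` on `Ω`. No square integrability is required. -/
def SolvesSchrodingerOn (U : ℂ → ℂ) (f : ℂ → ℂ) (E : ℂ) (Ω : Set ℂ) : Prop :=
  ∀ z ∈ Ω, -iteratedDeriv 2 f z + U z * f z = E * f z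

/-!
The seeds of the harmonic oscillator `-D² + z²` are the functions `exp (ε z² / 2) g`, with `ε = -1`
and `g` a Hermite polynomial (index `m ≥ 0`) or `ε = 1` and `g` a conjugate Hermite polynomial
(index `m < 0`); their eigenvalues are `2 m + 1`. Let `S` be the set of integers at which `M`
differs from the set of all negative integers. The pseudo-Wronskian of `M` is
`exp (s_M z² / 2) τ_S`, where `τ_S` is the Wronskian of the seeds with indices in `S`, so that `U_M`
is `z² - 2 (log τ_S)''`, and `ψ_{M,m}` is `τ_{S ∆ {m}} / τ_S`. Everything is expressed through the
logarithmic derivatives `u S` of the `τ_S`, which are rational functions, and the eigenvalue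
equation becomes a Riccati equation in the differential field `ℂ(z)`.

*Seeds are eigenfunctions.* Jacobi's determinant identity (`wdet_jacobi`) and the derivative of a
Wronskian (`deriv_wdet`) give `Wr[τ_{Sa}, τ_{Sb}] = τ_S τ_{Sab}` (`tauLogDeriv_sub_mul`). By
induction on the size of `S` (`tauPoly_ne_zero_and_riccati`) this shows that no `τ_S` vanishes
identically, and yields the Riccati equations for `v S m = u (S ∆ {m}) - u S` and the exchange
relation `(u (S ∆ {j, m}) - u S) (u (S ∆ {m}) - u (S ∆ {j})) = 2 j - 2 m`. These two relations
are invariant under all flips and are recorded in the structure `DarbouxSystem`.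

*There are no others.* The logarithmic derivative `R` of a quasi-rational eigenfunction is a
rational solution of the Riccati equation of `S` (`MayaDiagram.riccati_of_quasiRational`), so it has
to be shown that such an `R` equals some `v S m`. For `S = ∅`, writing `R` as a reduced fraction
`A / B` shows that `R = B' / B ± z` where `B` solves a Hermite equation
(`hermiteSystem_riccatiComplete_empty`). The general case follows by adding one element `j` to `S`
at a time: the inverse of the Darboux transformation brings `R` back to a smaller set, except when
its eigenvalue is `2 j + 1` and `R` is not the seed itself
(`DarbouxSystem.RiccatiComplete.flipSet`).
In that exceptional case `ψ²`, for the seed `ψ` of index `j`, would have an antiderivative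
`y ψ²` with `y` rational. This property is unaffected by flips at other indices, because the square
of a Darboux transform of `ψ` is a nonzero multiple of `ψ²` up to an exact term
(`DarbouxSystem.NonExact.flipSet`). It therefore suffices to exclude it for `S = ∅`, where repeated
integration by parts reduces `H_n² exp (± z²)` to a nonzero multiple of `exp (± z²)`
(`hermiteSystem_nonExact_empty`), and for `S = {j}`, where it contradicts the classification for
`S = ∅`.
-/

open Polynomial

/-! ### The derivation of the field of rational functions -/

namespace RatFunc

variable {k : Type*} [Field k]

/-- The derivative of a rational function, computed on its reduced fraction. -/
noncomputable def derivFun (f : RatFunc k) : RatFunc k :=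
  algebraMap k[X] (RatFunc k)
      (derivative f.num * f.denom - f.num * derivative f.denom) /
    algebraMap k[X] (RatFunc k) f.denom ^ 2

/-- The quotient rule, for fractions that need not be reduced. -/
theorem derivFun_div (p q : k[X]) (hq : q ≠ 0) :
    derivFun (algebraMap k[X] (RatFunc k) p / algebraMap k[X] (RatFunc k) q) =
      algebraMap k[X] (RatFunc k) (derivative p * q - p * derivative q) /
        algebraMap k[X] (RatFunc k) q ^ 2 := by
  set f := algebraMap k[X] (RatFunc k) p / algebraMap k[X] (RatFunc k) q with hf
  have hinj : Function.Injective (algebraMap k[X] (RatFunc k)) :=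
    IsFractionRing.injective _ _
  have hq' : algebraMap k[X] (RatFunc k) q ≠ 0 := by simpa using hq
  have hd : algebraMap k[X] (RatFunc k) f.denom ≠ 0 := by simpa using f.denom_ne_zero
  have h1 : f.num * q = p * f.denom := by
    apply hinj
    have := f.num_div_denom
    rw [hf, div_eq_div_iff hd hq', ← hf] at this
    simpa using this
  have h2 : derivative f.num * q + f.num * derivative q =
      derivative p * f.denom + p * derivative f.denom := by
    have := congrArg derivative h1
    simpa [derivative_mul] using this
  rw [derivFun, div_eq_div_iff (pow_ne_zero _ hd) (pow_ne_zero _ hq'), ← map_pow, ← map_pow,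
    ← map_mul, ← map_mul]
  congr 1
  linear_combination (q * f.denom) * h2 - (derivative f.denom * q + derivative q * f.denom) * h1

theorem exists_eq_div (f : RatFunc k) : ∃ p q : k[X], q ≠ 0 ∧
    f = algebraMap k[X] (RatFunc k) p / algebraMap k[X] (RatFunc k) q :=
  ⟨f.num, f.denom, f.denom_ne_zero, f.num_div_denom.symm⟩

theorem derivFun_add (f g : RatFunc k) : derivFun (f + g) = derivFun f + derivFun g := by
  obtain ⟨p, q, hq, rfl⟩ := exists_eq_div f
  obtain ⟨r, s, hs, rfl⟩ := exists_eq_div g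
  have hq' : algebraMap k[X] (RatFunc k) q ≠ 0 := by simpa using hq
  have hs' : algebraMap k[X] (RatFunc k) s ≠ 0 := by simpa using hs
  rw [div_add_div _ _ hq' hs', ← map_mul, ← map_mul, ← map_mul, ← map_add,
    derivFun_div _ _ (mul_ne_zero hq hs), derivFun_div _ _ hq, derivFun_div _ _ hs]
  simp only [derivative_mul, map_add, map_mul, map_sub]
  field_simp
  ring

theorem derivFun_mul (f g : RatFunc k) :
    derivFun (f * g) = f * derivFun g + g * derivFun f := by
  obtain ⟨p, q, hq, rfl⟩ := exists_eq_div f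
  obtain ⟨r, s, hs, rfl⟩ := exists_eq_div g
  have hq' : algebraMap k[X] (RatFunc k) q ≠ 0 := by simpa using hq
  have hs' : algebraMap k[X] (RatFunc k) s ≠ 0 := by simpa using hs
  rw [div_mul_div_comm, ← map_mul, ← map_mul,
    derivFun_div _ _ (mul_ne_zero hq hs), derivFun_div _ _ hq, derivFun_div _ _ hs]
  simp only [derivative_mul, map_add, map_mul, map_sub]
  field_simp
  ring

theorem derivFun_algebraMap (p : k[X]) :
    derivFun (algebraMap k[X] (RatFunc k) p) = algebraMap k[X] (RatFunc k) (derivative p) := by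
  have h := derivFun_div p 1 one_ne_zero
  simpa using h

/-- The derivation `d/dX` of the field of rational functions. -/
noncomputable def ddX : Derivation k (RatFunc k) (RatFunc k) :=
  Derivation.mk'
    { toFun := derivFun
      map_add' := derivFun_add
      map_smul' := fun c f => by
        have h : algebraMap k (RatFunc k) c = algebraMap k[X] (RatFunc k) (Polynomial.C c) := rfl
        rw [Algebra.smul_def, derivFun_mul, h, derivFun_algebraMap, derivative_C, map_zero,
          mul_zero, add_zero, RingHom.id_apply, Algebra.smul_def, h] }
    derivFun_mul

theorem ddX_algebraMap (p : k[X]) :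
    ddX (algebraMap k[X] (RatFunc k) p) = algebraMap k[X] (RatFunc k) (derivative p) :=
  derivFun_algebraMap p

theorem ddX_div (p q : k[X]) (hq : q ≠ 0) :
    ddX (algebraMap k[X] (RatFunc k) p / algebraMap k[X] (RatFunc k) q) =
      algebraMap k[X] (RatFunc k) (derivative p * q - p * derivative q) /
        algebraMap k[X] (RatFunc k) q ^ 2 :=
  derivFun_div p q hq

end RatFunc

/-! ### Riccati equations in a differential field -/

namespace Riccati

variable {k K : Type*} [CommRing k] [Field K] [Algebra k K] (D : Derivation k K K)

theorem deriv_inv (w : K) : D w⁻¹ = -D w / w ^ 2 := by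
  rw [Derivation.leibniz_inv, smul_eq_mul]
  ring

theorem deriv_div {a b : K} (hb : b ≠ 0) : D (a / b) = (D a * b - a * D b) / b ^ 2 := by
  rw [Derivation.leibniz_div, smul_eq_mul, smul_eq_mul, smul_eq_mul]
  field_simp

theorem deriv_mul (a b : K) : D (a * b) = D a * b + a * D b := by
  rw [Derivation.leibniz, smul_eq_mul, smul_eq_mul]
  ring

/-- One Darboux step on logarithmic derivatives. Here `u₀, ua, ub, uab` are the logarithmic
derivatives of four functions `τ₀, τa, τb, τab` with `Wr[τa, τb] = τ₀ τab`. -/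
theorem darboux {Q u₀ ua ub uab la lb : K} (hla : D la = 0) (hlb : D lb = 0)
    (ha : D (ua - u₀) + (ua - u₀) ^ 2 = Q - 2 * D u₀ - la)
    (hb : D (ub - u₀) + (ub - u₀) ^ 2 = Q - 2 * D u₀ - lb)
    (hne : ub - ua ≠ 0) (hd : D (ub - ua) = (u₀ + uab - ua - ub) * (ub - ua)) :
    (uab - u₀) * (ub - ua) = la - lb ∧
      D (uab - ua) + (uab - ua) ^ 2 = Q - 2 * D ua - lb := by
  have h1 : (uab - u₀) * (ub - ua) = la - lb := by
    simp only [map_sub] at ha hb hd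
    linear_combination hb - ha - hd
  have h2 : D ((uab - u₀) * (ub - ua)) = 0 := by rw [h1, map_sub, hla, hlb, sub_zero]
  rw [deriv_mul] at h2
  have h3 : D (uab - u₀) = -(uab - u₀) * (u₀ + uab - ua - ub) := by
    apply mul_right_cancel₀ hne
    linear_combination h2 - (uab - u₀) * hd
  refine ⟨h1, ?_⟩
  simp only [map_sub] at ha h3 ⊢
  linear_combination h3 + ha + h1

end Riccati

/-! ### Flips of finite sets and the transfer of Riccati solutions -/

/-- The flip of a finite set of integers at `m`. -/
def flipSet (S : Finset ℤ) (m : ℤ) : Finset ℤ := symmDiff S {m}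

theorem flipSet_flipSet (S : Finset ℤ) (m : ℤ) : flipSet (flipSet S m) m = S := by
  simp [flipSet]

theorem flipSet_comm (S : Finset ℤ) (j m : ℤ) :
    flipSet (flipSet S j) m = flipSet (flipSet S m) j := by
  simp only [flipSet, symmDiff_assoc, symmDiff_comm {j}]

theorem mem_flipSet_self {S : Finset ℤ} {m : ℤ} : m ∈ flipSet S m ↔ m ∉ S := by
  simp [flipSet, Finset.mem_symmDiff]

theorem mem_flipSet_of_ne {S : Finset ℤ} {j m : ℤ} (h : j ≠ m) : j ∈ flipSet S m ↔ j ∈ S := by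
  simp [flipSet, Finset.mem_symmDiff, h]

theorem flipSet_of_notMem {S : Finset ℤ} {m : ℤ} (h : m ∉ S) : flipSet S m = insert m S := by
  ext x
  by_cases hx : x = m <;> simp [flipSet, Finset.mem_symmDiff, hx, h]

/-- A family of elements `u S` of a differential field, which play the role of the logarithmic
derivatives of the tau functions of a potential `Q` and its rational Darboux transforms: the
potential attached to `S` is `Q - 2 (u S)'`, and `u (S ∆ {m}) - u S` is the logarithmic derivative
of an eigenfunction with eigenvalue `lam m`. -/
structure DarbouxSystem {k K : Type*} [CommRing k] [Field K] [Algebra k K]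
    (D : Derivation k K K) (Q : K) (lam : ℤ → K) where
  u : Finset ℤ → K
  lam_injective : Function.Injective lam
  deriv_lam : ∀ m, D (lam m) = 0
  riccati : ∀ S m, D (u (flipSet S m) - u S) + (u (flipSet S m) - u S) ^ 2 =
    Q - 2 * D (u S) - lam m
  exchange : ∀ S j m, j ≠ m → (u (flipSet (flipSet S j) m) - u S) *
    (u (flipSet S m) - u (flipSet S j)) = lam j - lam m

namespace DarbouxSystem

variable {k K : Type*} [CommRing k] [Field K] [Algebra k K]
  {D : Derivation k K K} {Q : K} {lam : ℤ → K} (A : DarbouxSystem D Q lam)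

/-- The logarithmic derivative of the seed eigenfunction of index `m` for the potential of `S`. -/
def v (S : Finset ℤ) (m : ℤ) : K := A.u (flipSet S m) - A.u S

theorem riccati_v (S : Finset ℤ) (m : ℤ) :
    D (A.v S m) + A.v S m ^ 2 = Q - 2 * D (A.u S) - lam m := A.riccati S m

theorem v_flipSet_self (S : Finset ℤ) (m : ℤ) : A.v (flipSet S m) m = -A.v S m := by
  rw [v, v, flipSet_flipSet]
  ring

theorem exchange_v (S : Finset ℤ) {j m : ℤ} (h : j ≠ m) :
    (A.v (flipSet S j) m + A.v S j) * (A.v S m - A.v S j) = lam j - lam m := by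
  rw [← A.exchange S j m h, v, v, v]
  ring

theorem v_sub_ne_zero (S : Finset ℤ) {j m : ℤ} (h : j ≠ m) : A.v S m - A.v S j ≠ 0 := by
  intro h0
  have := A.exchange_v S h
  rw [h0, mul_zero] at this
  exact h (A.lam_injective (sub_eq_zero.1 this.symm))

/-- Every solution in `K` of a Riccati equation attached to `S`, with a constant eigenvalue, is the
logarithmic derivative of one of the seeds. -/
def RiccatiComplete (S : Finset ℤ) : Prop :=
  ∀ (R : K) (l : k), D R + R ^ 2 = Q - 2 * D (A.u S) - algebraMap k K l →
    ∃ m, algebraMap k K l = lam m ∧ R = A.v S m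

/-- With `ψ` the seed of index `m` for `S`: the function `ψ²` has no antiderivative of the form
`y ψ²` with `y` in `K`. -/
def NonExact (S : Finset ℤ) (m : ℤ) : Prop :=
  ∀ y : K, D y + 2 * A.v S m * y ≠ 1

/-- Transport of `RiccatiComplete` along a Darboux transformation. The inverse transformation
carries a solution back unless its eigenvalue is that of the seed; a solution with that eigenvalue
would provide an antiderivative of `ψ²`. -/
theorem RiccatiComplete.flipSet {S : Finset ℤ} {j : ℤ} (hS : A.RiccatiComplete S)
    (hN : A.NonExact S j) : A.RiccatiComplete (flipSet S j) := by
  intro R l₀ hR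
  have hl : D (algebraMap k K l₀) = 0 := D.map_algebraMap l₀
  set l := algebraMap k K l₀
  obtain ⟨w, hw⟩ : ∃ w, w = R + A.v S j := ⟨_, rfl⟩
  obtain rfl : R = w - A.v S j := by rw [hw]; ring
  have hv := A.riccati_v S j
  have hu : A.u (_root_.flipSet S j) = A.u S + A.v S j := by rw [v]; ring
  rw [hu] at hR
  have hDw : D w = lam j - l - w ^ 2 + 2 * w * A.v S j := by
    simp only [map_sub, map_add] at hR
    linear_combination hR - hv
  by_cases hc : lam j = l
  · refine ⟨j, hc.symm, ?_⟩
    rw [v_flipSet_self]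
    by_cases hw0 : w = 0
    · rw [hw0, zero_sub]
    · refine absurd ?_ (hN w⁻¹)
      rw [Riccati.deriv_inv, hDw, hc]
      field_simp
      ring
  · have hc' : lam j - l ≠ 0 := sub_ne_zero.2 hc
    have hw0 : w ≠ 0 := by
      rintro rfl
      rw [map_zero] at hDw
      apply hc'
      linear_combination -hDw
    obtain ⟨m, hm, hRm⟩ := hS (A.v S j + (lam j - l) / w) l₀ (by
      rw [map_add, Riccati.deriv_div D hw0, map_sub, A.deriv_lam, hl, hDw]
      field_simp
      linear_combination w ^ 2 * hv)
    change l = lam m at hm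
    have hjm : j ≠ m := by
      rintro rfl
      exact hc hm.symm
    refine ⟨m, hm, ?_⟩
    have hex := A.exchange_v S hjm
    rw [← hRm, ← hm, add_sub_cancel_left] at hex
    have h1 : A.v (_root_.flipSet S j) m + A.v S j = w := by
      apply mul_right_cancel₀ (div_ne_zero hc' hw0)
      rw [hex]
      field_simp
    rw [← h1]
    ring

/-- With `A ψ` the Darboux transform of `ψ`, the function `(A ψ)²` differs from a nonzero multiple
of `ψ²` by the derivative of `ψ A ψ`. -/
theorem NonExact.flipSet {S : Finset ℤ} {j m : ℤ} (hjm : j ≠ m) (hN : A.NonExact S m) :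
    A.NonExact (flipSet S j) m := by
  intro y hy
  have hc : lam m - lam j ≠ 0 := sub_ne_zero.2 fun h => hjm (A.lam_injective h.symm)
  have hd := A.v_sub_ne_zero S hjm
  obtain ⟨d, hd'⟩ : ∃ d, d = A.v S m - A.v S j := ⟨_, rfl⟩
  have hex := A.exchange_v S hjm
  have hj := A.riccati_v S j
  have hm := A.riccati_v S m
  have hvm : A.v S m = d + A.v S j := by rw [hd']; ring
  rw [← hd'] at hd hex
  rw [hvm, map_add] at hm
  have hDd : D d = lam j - lam m - d ^ 2 - 2 * d * A.v S j := by linear_combination hm - hj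
  have hv : A.v (_root_.flipSet S j) m = (lam j - lam m) / d - A.v S j := by
    rw [← hex]
    field_simp
    ring
  rw [hv] at hy
  refine hN ((y * d ^ 2 - d) / (lam m - lam j)) ?_
  have hc0 : D (lam m - lam j) = 0 := by rw [map_sub, A.deriv_lam, A.deriv_lam, sub_zero]
  rw [Riccati.deriv_div D hc, hc0, map_sub, Riccati.deriv_mul, pow_two d, Riccati.deriv_mul, hDd,
    hvm]
  field_simp
  field_simp at hy
  linear_combination (lam m - lam j) * d * hy

end DarbouxSystem

/-! ### Determinants of Wronskian type -/

section WronskianType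

variable {ι R : Type*} [CommRing R]

/-- The determinant of the first `n` columns of the rows `r (e 0), …, r (e (n - 1))`. When
`r a j` is the `j`-th derivative of a function, this is a Wronskian. -/
def wdet (r : ι → ℕ → R) {n : ℕ} (e : Fin n → ι) : R :=
  Matrix.det (Matrix.of fun i j : Fin n => r (e i) j)

/-- The determinant `wdet` with its last column replaced by the next one. -/
def wdetShift (r : ι → ℕ → R) {n : ℕ} (e : Fin (n + 1) → ι) : R :=
  Matrix.det (Matrix.of fun i j : Fin (n + 1) => r (e i) (if j = Fin.last n then n + 1 else j))

theorem wdet_zero (r : ι → ℕ → R) (e : Fin 0 → ι) : wdet r e = 1 := by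
  simp [wdet]

theorem wdet_one (r : ι → ℕ → R) (e : Fin 1 → ι) : wdet r e = r (e 0) 0 := by
  simp [wdet]

theorem wdet_comp_perm (r : ι → ℕ → R) {n : ℕ} (e : Fin n → ι) (σ : Equiv.Perm (Fin n)) :
    wdet r (e ∘ σ) = Equiv.Perm.sign σ * wdet r e :=
  Matrix.det_permute σ (Matrix.of fun i j : Fin n => r (e i) j)

/-- If each row satisfies the twisted rule `r' = shift - c r`, then so does the determinant, because
differentiating any column but the last one produces two equal columns. -/
theorem deriv_wdet {k : Type*} [CommRing k] [Algebra k R] (D : Derivation k R R)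
    (r : ι → ℕ → R) (c : ι → R) (hr : ∀ a j, D (r a j) = r a (j + 1) - c a * r a j)
    {n : ℕ} (e : Fin (n + 1) → ι) :
    D (wdet r e) = wdetShift r e - (∑ i, c (e i)) * wdet r e := by
  classical
  have hprod : ∀ (s : Finset (Fin (n + 1))) (g : Fin (n + 1) → R),
      D (∏ i ∈ s, g i) = ∑ i ∈ s, (∏ j ∈ s.erase i, g j) * D (g i) := by
    intro s g
    induction s using Finset.induction_on with
    | empty => simp
    | insert a s ha ih =>
      rw [Finset.prod_insert ha, Derivation.leibniz, ih, Finset.sum_insert ha,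
        Finset.erase_insert ha, smul_eq_mul, smul_eq_mul, Finset.mul_sum, add_comm]
      congr 1
      refine Finset.sum_congr rfl fun i hi => ?_
      have hia : i ≠ a := fun h => ha (h ▸ hi)
      rw [Finset.erase_insert_of_ne hia.symm, Finset.prod_insert (by simp [ha]), mul_assoc]
  set N : Matrix (Fin (n + 1)) (Fin (n + 1)) R := Matrix.of fun i j => r (e i) j with hN
  have hcol : ∀ i : Fin (n + 1), i ≠ Fin.last n →
      (N.updateCol i fun a => r (e a) (i + 1)).det = 0 := by
    intro i hi
    have hlt : (i : ℕ) + 1 < n + 1 := by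
      have := Fin.val_lt_last hi
      omega
    refine Matrix.det_zero_of_column_eq (i := i) (j := ⟨i + 1, hlt⟩) ?_ fun a => ?_
    · intro h
      have := congrArg Fin.val h
      simp at this
    · rw [Matrix.updateCol_self, Matrix.updateCol_ne]
      · rfl
      · intro h
        have := congrArg Fin.val h
        simp at this
  have hlast : (N.updateCol (Fin.last n) fun a => r (e a) (n + 1)).det = wdetShift r e := by
    rw [wdetShift]
    congr 1
    ext a j
    by_cases hj : j = Fin.last n
    · subst hj
      simp
    · rw [Matrix.updateCol_ne hj]
      simp [hN, hj]
  have hupd : ∀ i : Fin (n + 1), (N.updateCol i fun a => r (e a) (i + 1)).det =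
      ∑ σ : Equiv.Perm (Fin (n + 1)), (Equiv.Perm.sign σ : ℤ) •
        ((∏ j ∈ Finset.univ.erase i, N (σ j) j) * r (e (σ i)) (i + 1)) := by
    intro i
    rw [Matrix.det_apply]
    refine Finset.sum_congr rfl fun σ _ => ?_
    rw [← Finset.prod_erase_mul _ _ (Finset.mem_univ i), Matrix.updateCol_self]
    congr 2
    refine Finset.prod_congr rfl fun j hj => ?_
    rw [Matrix.updateCol_ne (Finset.ne_of_mem_erase hj)]
  have hsum : wdetShift r e = ∑ i : Fin (n + 1), (N.updateCol i fun a => r (e a) (i + 1)).det := by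
    rw [Finset.sum_eq_single (Fin.last n) (fun i _ hi => hcol i hi) (by simp), ← hlast]
    simp
  have hdet : wdet r e = ∑ σ : Equiv.Perm (Fin (n + 1)), (Equiv.Perm.sign σ : ℤ) •
      ∏ j, N (σ j) j := Matrix.det_apply N
  rw [hsum, Finset.sum_congr rfl fun i _ => hupd i, Finset.sum_comm, hdet, map_sum, Finset.mul_sum,
    ← Finset.sum_sub_distrib]
  refine Finset.sum_congr rfl fun σ _ => ?_
  rw [map_zsmul, hprod, ← Finset.smul_sum, mul_smul_comm, ← smul_sub]
  congr 1
  rw [← Equiv.sum_comp σ fun i => c (e i), Finset.sum_mul, ← Finset.sum_sub_distrib]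
  refine Finset.sum_congr rfl fun i _ => ?_
  rw [← Finset.prod_erase_mul _ _ (Finset.mem_univ i), hN, Matrix.of_apply, hr]
  ring

end WronskianType

section Jacobi

open Matrix

variable {ι K : Type*} [Field K]

/-- The entry in column `c` of the row `a` after the rows `r (e i)` have been used to clear its
first `n` entries. -/
noncomputable def schurEntry (r : ι → ℕ → K) {n : ℕ} (e : Fin n → ι) (a : ι) (c : ℕ) : K :=
  r a c - ((Matrix.of fun (_ : Unit) (j : Fin n) => r a j) *
    (Matrix.of fun i j : Fin n => r (e i) j)⁻¹ *
    (Matrix.of fun (i : Fin n) (_ : Unit) => r (e i) c)) () ()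

/-- Elimination of the rows `a i` by the rows `r (e i)` (the Schur complement formula). -/
theorem det_append_eq (r : ι → ℕ → K) {n m : ℕ} (e : Fin n → ι) (h : wdet r e ≠ 0)
    (a : Fin m → ι) (col : Fin (n + m) → ℕ) (hcol : ∀ j : Fin n, col (Fin.castAdd m j) = j) :
    det (of fun i j : Fin (n + m) => r (Fin.append e a i) (col j)) =
      wdet r e * det (of fun i j : Fin m => schurEntry r e (a i) (col (Fin.natAdd n j))) := by
  set A : Matrix (Fin n) (Fin n) K := of fun i j : Fin n => r (e i) j with hA
  have hdet : IsUnit A.det := isUnit_iff_ne_zero.2 h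
  let := A.invertibleOfIsUnitDet hdet
  have hblock : (of fun i j : Fin (n + m) => r (Fin.append e a i) (col j)).submatrix
      finSumFinEquiv finSumFinEquiv =
      fromBlocks A (of fun i j => r (e i) (col (Fin.natAdd n j))) (of fun i j => r (a i) j)
        (of fun i j => r (a i) (col (Fin.natAdd n j))) := by
    ext (i | i) (j | j) <;> simp [hA, hcol]
  rw [← det_submatrix_equiv_self finSumFinEquiv, hblock, det_fromBlocks₁₁]
  congr 2

/-- Jacobi's identity for the minors that omit one of the last two rows and one of the last two
columns. -/
theorem wdet_jacobi (r : ι → ℕ → K) {n : ℕ} (e : Fin n → ι) (h : wdet r e ≠ 0) (a b : ι) :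
    wdet r (Fin.append e ![a]) * wdetShift r (Fin.append e ![b]) -
        wdetShift r (Fin.append e ![a]) * wdet r (Fin.append e ![b]) =
      wdet r e * wdet r (Fin.append e ![a, b]) := by
  have h1 : ∀ a, wdet r (Fin.append e ![a]) = wdet r e * schurEntry r e a n := fun a => by
    rw [wdet, det_append_eq r e h ![a] (fun j => j) (fun j => rfl)]
    simp
  have h2 : ∀ a, wdetShift r (Fin.append e ![a]) = wdet r e * schurEntry r e a (n + 1) :=
    fun a => by
      rw [wdetShift, det_append_eq r e h ![a] (fun j => if j = Fin.last n then n + 1 else j)]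
      · simp [Fin.ext_iff]
      · intro j
        have := j.isLt
        simp [Fin.ext_iff, this.ne]
  have h3 : wdet r (Fin.append e ![a, b]) = wdet r e *
      (schurEntry r e a n * schurEntry r e b (n + 1) -
        schurEntry r e a (n + 1) * schurEntry r e b n) := by
    rw [wdet, det_append_eq r e h ![a, b] (fun j => j) (fun j => rfl), det_fin_two]
    simp
  rw [h1, h1, h2, h2, h3]
  ring

end Jacobi

/-! ### Hermite polynomials and the eigenfunctions of the harmonic oscillator -/

/-- The polynomials with `G 0 = 1` and `G (n + 1) = 2 X G n + ε (G n)'`: for `ε = -1` the Hermite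
polynomials, for `ε = 1` the conjugate Hermite polynomials. -/
noncomputable def hermitePoly (ε : ℂ) : ℕ → ℂ[X]
  | 0 => 1
  | n + 1 => 2 * X * hermitePoly ε n + C ε * derivative (hermitePoly ε n)

theorem hermitePoly_succ (ε : ℂ) (n : ℕ) : hermitePoly ε (n + 1) =
    2 * X * hermitePoly ε n + C ε * derivative (hermitePoly ε n) := rfl

theorem derivative_hermitePoly_succ (ε : ℂ) (n : ℕ) :
    derivative (hermitePoly ε (n + 1)) = 2 * ((n : ℂ[X]) + 1) * hermitePoly ε n := by
  induction n with
  | zero => simp [hermitePoly]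
  | succ n ih =>
    rw [hermitePoly_succ ε (n + 1), derivative_add, derivative_mul, ih]
    simp only [derivative_mul, derivative_C, derivative_X, derivative_ofNat, derivative_add,
      derivative_natCast, derivative_one]
    push_cast
    linear_combination (-2 * ((n : ℂ[X]) + 1)) * hermitePoly_succ ε n

theorem hermitePoly_ode (ε : ℂ) (n : ℕ) :
    C ε * derivative (derivative (hermitePoly ε n)) + 2 * X * derivative (hermitePoly ε n) =
      2 * (n : ℂ[X]) * hermitePoly ε n := by
  have h := derivative_hermitePoly_succ ε n
  rw [hermitePoly_succ] at h
  simp only [derivative_mul, derivative_C, derivative_X, derivative_ofNat, derivative_add] at h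
  linear_combination h

theorem hermitePoly_natDegree_le_and_coeff (ε : ℂ) (n : ℕ) :
    (hermitePoly ε n).natDegree ≤ n ∧ (hermitePoly ε n).coeff n = 2 ^ n := by
  induction n with
  | zero => simp [hermitePoly]
  | succ n ih =>
    have hd : (derivative (hermitePoly ε n)).natDegree ≤ n :=
      (natDegree_derivative_le _).trans (by omega)
    rw [hermitePoly_succ]
    constructor
    · refine natDegree_add_le_of_degree_le ?_ ?_
      · rw [mul_comm 2 X, mul_assoc]
        refine natDegree_mul_le.trans ?_
        have h2 : (2 * hermitePoly ε n).natDegree ≤ n := by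
          rw [← C_ofNat]
          exact (natDegree_C_mul_le _ _).trans ih.1
        rw [natDegree_X]
        omega
      · exact (natDegree_C_mul_le _ _).trans (by omega)
    · rw [coeff_add, coeff_C_mul, coeff_eq_zero_of_natDegree_lt (p := derivative _) (by omega),
        mul_zero, add_zero, mul_comm 2 X, mul_assoc, coeff_X_mul, ← C_ofNat, coeff_C_mul, ih.2,
        pow_succ]
      ring

theorem hermitePoly_coeff_self (ε : ℂ) (n : ℕ) : (hermitePoly ε n).coeff n = 2 ^ n :=
  (hermitePoly_natDegree_le_and_coeff ε n).2

theorem hermitePoly_ne_zero (ε : ℂ) (n : ℕ) : hermitePoly ε n ≠ 0 := by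
  intro h
  have := hermitePoly_coeff_self ε n
  rw [h, coeff_zero] at this
  exact pow_ne_zero n two_ne_zero this.symm

/-- The sign `ε` such that the seed of index `m` of the harmonic oscillator is
`exp (ε z² / 2)` times a polynomial. -/
noncomputable def seedSign (m : ℤ) : ℂ := if m < 0 then 1 else -1

/-- The degree of the polynomial factor of the seed of index `m`. -/
def seedDegree (m : ℤ) : ℕ := if m < 0 then (-m - 1).toNat else m.toNat

theorem seedSign_sq (m : ℤ) : seedSign m ^ 2 = 1 := by
  unfold seedSign
  split_ifs <;> norm_num

theorem seed_eigenvalue (m : ℤ) :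
    -seedSign m * (2 * (seedDegree m : ℂ) + 1) = 2 * (m : ℂ) + 1 := by
  unfold seedSign seedDegree
  split_ifs with h
  · have : (((-m - 1).toNat : ℕ) : ℂ) = ((-m - 1 : ℤ) : ℂ) := by
      rw [← Int.cast_natCast, Int.toNat_of_nonneg (by omega)]
    rw [this]
    push_cast
    ring
  · have : ((m.toNat : ℕ) : ℂ) = (m : ℂ) := by
      rw [← Int.cast_natCast, Int.toNat_of_nonneg (by omega)]
    rw [this]
    ring

/-- The polynomials `exp (-c z²) (d/dz)^j (exp (c z²) G)`, where `G` is the polynomial factor of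
the seed of index `m` and `c = (1 + ε) / 2`. -/
noncomputable def seedRow (m : ℤ) : ℕ → ℂ[X]
  | 0 => hermitePoly (seedSign m) (seedDegree m)
  | j + 1 => derivative (seedRow m j) + C (1 + seedSign m) * X * seedRow m j

/-! ### Tau functions and the Darboux system of the harmonic oscillator -/

local notation "toK" => algebraMap ℂ[X] (RatFunc ℂ)
local notation "DK" => RatFunc.ddX (k := ℂ)

/-- The polynomial part of the Wronskian of the seeds of indices `e 0, …, e (n - 1)`. -/
noncomputable def tauPoly {n : ℕ} (e : Fin n → ℤ) : ℂ[X] := wdet seedRow e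

/-- The logarithmic derivative of the Wronskian of the seeds of indices `e 0, …, e (n - 1)`. -/
noncomputable def tauLogDeriv {n : ℕ} (e : Fin n → ℤ) : RatFunc ℂ :=
  toK (C (∑ i, seedSign (e i)) * X) + DK (toK (tauPoly e)) / toK (tauPoly e)

theorem toK_ne_zero {p : ℂ[X]} (h : p ≠ 0) : toK p ≠ 0 := by simpa using h

theorem toK_tauPoly {n : ℕ} (e : Fin n → ℤ) :
    toK (tauPoly e) = wdet (fun m j => toK (seedRow m j)) e := by
  rw [tauPoly, wdet, RingHom.map_det]
  rfl

theorem append_append {α : Type*} {n : ℕ} (e : Fin n → α) (a b : α) :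
    Fin.append (Fin.append e ![a]) ![b] = Fin.append e ![a, b] := by
  have h : Fin.append ![a] ![b] = ![a, b] := by
    ext i
    fin_cases i <;> rfl
  rw [← h]
  ext i
  rw [Fin.append_assoc]
  rfl

theorem append_castSucc_last {α : Type*} {n : ℕ} (e : Fin (n + 1) → α) :
    Fin.append (e ∘ Fin.castSucc) ![e (Fin.last n)] = e := by
  rw [Fin.append_right_eq_snoc]
  exact Fin.snoc_init_self e

theorem sum_append_one {n : ℕ} (e : Fin n → ℤ) (a : ℤ) :
    ∑ i, seedSign (Fin.append e ![a] i) = ∑ i, seedSign (e i) + seedSign a := by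
  rw [Fin.append_right_eq_snoc, Fin.sum_univ_castSucc]
  simp

theorem deriv_tauPoly {n : ℕ} (e : Fin (n + 1) → ℤ) :
    DK (toK (tauPoly e)) = wdetShift (fun m j => toK (seedRow m j)) e -
      (((n : ℂ[X]) + 1 + C (∑ i, seedSign (e i))) * X : ℂ[X]) • toK (tauPoly e) := by
  rw [toK_tauPoly, deriv_wdet DK _ (fun m => toK (C (1 + seedSign m) * X))]
  · congr 1
    rw [Algebra.smul_def]
    congr 1
    rw [← map_sum, ← Finset.sum_mul, ← map_sum, Finset.sum_add_distrib]
    simp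
  · intro a j
    rw [RatFunc.ddX_algebraMap, seedRow, map_add, map_mul _ (C (1 + seedSign a) * X)]
    ring

/-- The Wronskian of `τ_a` and `τ_b` is `τ τ_ab`. -/
theorem tauLogDeriv_sub_mul {n : ℕ} (e : Fin n → ℤ) (a b : ℤ) (h : tauPoly e ≠ 0)
    (ha : tauPoly (Fin.append e ![a]) ≠ 0) (hb : tauPoly (Fin.append e ![b]) ≠ 0) :
    (tauLogDeriv (Fin.append e ![b]) - tauLogDeriv (Fin.append e ![a])) *
        (toK (tauPoly (Fin.append e ![a])) * toK (tauPoly (Fin.append e ![b]))) =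
      toK (tauPoly e) * toK (tauPoly (Fin.append e ![a, b])) := by
  have h' := toK_ne_zero h
  have ha' := toK_ne_zero ha
  have hb' := toK_ne_zero hb
  rw [toK_tauPoly] at h'
  have hJ := wdet_jacobi (fun m j => toK (seedRow m j)) e h' a b
  simp only [← toK_tauPoly] at hJ
  rw [← hJ, tauLogDeriv, tauLogDeriv]
  have h1 := deriv_tauPoly (Fin.append e ![a])
  have h2 := deriv_tauPoly (Fin.append e ![b])
  rw [Algebra.smul_def] at h1 h2
  field_simp
  rw [h1, h2]
  simp only [map_add, map_mul]
  ring

theorem injective_append_one {n : ℕ} {e : Fin n → ℤ} (he : Function.Injective e) {a : ℤ}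
    (ha : a ∉ Set.range e) : Function.Injective (Fin.append e ![a]) := by
  rw [Fin.append_right_eq_snoc]
  exact Fin.snoc_injective_iff.2 ⟨he, ha⟩

/-- The logarithmic derivative of the identity `Wr[τ_a, τ_b] = τ τ_ab`. -/
theorem deriv_logDeriv_eq {n : ℕ} (e : Fin n → ℤ) (a b : ℤ) (h : tauPoly e ≠ 0)
    (ha : tauPoly (Fin.append e ![a]) ≠ 0) (hb : tauPoly (Fin.append e ![b]) ≠ 0)
    (hab : tauPoly (Fin.append e ![a, b]) ≠ 0) :
    DK (tauLogDeriv (Fin.append e ![b]) - tauLogDeriv (Fin.append e ![a])) =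
      (tauLogDeriv e + tauLogDeriv (Fin.append e ![a, b]) - tauLogDeriv (Fin.append e ![a]) -
        tauLogDeriv (Fin.append e ![b])) *
      (tauLogDeriv (Fin.append e ![b]) - tauLogDeriv (Fin.append e ![a])) := by
  have h' := toK_ne_zero h
  have ha' := toK_ne_zero ha
  have hb' := toK_ne_zero hb
  have hab' := toK_ne_zero hab
  have key := tauLogDeriv_sub_mul e a b h ha hb
  obtain ⟨d, hd⟩ : ∃ d, d = tauLogDeriv (Fin.append e ![b]) - tauLogDeriv (Fin.append e ![a]) :=
    ⟨_, rfl⟩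
  rw [← hd] at key ⊢
  have hD := congrArg DK key
  simp only [Riccati.deriv_mul] at hD
  have hsum : (∑ i, seedSign (Fin.append e ![a, b] i)) =
      ∑ i, seedSign (e i) + seedSign a + seedSign b := by
    rw [← append_append, sum_append_one, sum_append_one]
  simp only [tauLogDeriv, sum_append_one, hsum, map_add, add_mul]
  apply mul_right_cancel₀ (mul_ne_zero ha' hb')
  field_simp
  linear_combination toK (tauPoly e) * toK (tauPoly (Fin.append e ![a, b])) * hD -
    (toK (tauPoly e) * DK (toK (tauPoly (Fin.append e ![a, b]))) +
      DK (toK (tauPoly e)) * toK (tauPoly (Fin.append e ![a, b]))) * key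

/-- The eigenvalue `2 m + 1` as a constant of `ℂ(X)`. -/
noncomputable def seedEigenvalue (m : ℤ) : RatFunc ℂ := algebraMap ℂ (RatFunc ℂ) (2 * (m : ℂ) + 1)

theorem ddX_algebraMap_const (c : ℂ) : DK (algebraMap ℂ (RatFunc ℂ) c) = 0 :=
  RatFunc.ddX.map_algebraMap c

theorem seedEigenvalue_injective : Function.Injective seedEigenvalue := by
  intro a b h
  have := (algebraMap ℂ (RatFunc ℂ)).injective h
  have h2 : (a : ℂ) = b := by linear_combination this / 2
  exact_mod_cast h2

theorem algebraMap_const_eq (c : ℂ) : algebraMap ℂ (RatFunc ℂ) c = toK (C c) := rfl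

theorem tauPoly_one (a : ℤ) (e : Fin 0 → ℤ) :
    tauPoly (Fin.append e ![a]) = hermitePoly (seedSign a) (seedDegree a) := by
  rw [tauPoly]
  exact wdet_one _ _

/-- The Riccati equation of the seeds of the harmonic oscillator. -/
theorem hermite_riccati (m : ℤ) :
    DK (toK (C (seedSign m) * X) + DK (toK (hermitePoly (seedSign m) (seedDegree m))) /
        toK (hermitePoly (seedSign m) (seedDegree m))) +
      (toK (C (seedSign m) * X) + DK (toK (hermitePoly (seedSign m) (seedDegree m))) /
        toK (hermitePoly (seedSign m) (seedDegree m))) ^ 2 =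
      toK (X ^ 2) - seedEigenvalue m := by
  have h := toK_ne_zero (hermitePoly_ne_zero (seedSign m) (seedDegree m))
  have hode := congrArg toK (hermitePoly_ode (seedSign m) (seedDegree m))
  have hs := congrArg toK (congrArg C (seedSign_sq m))
  simp only [map_add, map_mul, map_pow, map_one, map_ofNat, map_natCast,
    ← RatFunc.ddX_algebraMap] at hode hs
  rw [map_add, Riccati.deriv_div _ h, seedEigenvalue, algebraMap_const_eq, ← seed_eigenvalue,
    RatFunc.ddX_algebraMap (C (seedSign m) * X)]
  simp only [derivative_mul, derivative_C, derivative_X, map_add, map_mul, map_pow, map_one,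
    map_ofNat, map_natCast, zero_mul, zero_add, mul_one, map_neg]
  field_simp
  set G := toK (hermitePoly (seedSign m) (seedDegree m))
  set s := toK (C (seedSign m))
  linear_combination s * G * hode + (toK X ^ 2 * G ^ 2 - G * DK (DK G)) * hs

/-- No Wronskian of seeds with distinct indices vanishes, and enlarging it by one seed gives an
eigenfunction for its potential. Each step is a Darboux transformation by the seed `a` that was
added last; the next Wronskian does not vanish because seeds with different eigenvalues have
different logarithmic derivatives. -/
theorem tauPoly_ne_zero_and_riccati (n : ℕ) : ∀ e : Fin n → ℤ, Function.Injective e →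
    tauPoly e ≠ 0 ∧ ∀ a ∉ Set.range e, tauPoly (Fin.append e ![a]) ≠ 0 ∧
      DK (tauLogDeriv (Fin.append e ![a]) - tauLogDeriv e) +
        (tauLogDeriv (Fin.append e ![a]) - tauLogDeriv e) ^ 2 =
      toK (X ^ 2) - 2 * DK (tauLogDeriv e) - seedEigenvalue a := by
  induction n with
  | zero =>
    intro e _
    have h1 : tauPoly e = 1 := wdet_zero _ _
    refine ⟨by rw [h1]; exact one_ne_zero, fun a _ => ⟨?_, ?_⟩⟩
    · rw [tauPoly_one]
      exact hermitePoly_ne_zero _ _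
    · have h0 : tauLogDeriv e = 0 := by simp [tauLogDeriv, h1]
      have h2 : tauLogDeriv (Fin.append e ![a]) = toK (C (seedSign a) * X) +
          DK (toK (hermitePoly (seedSign a) (seedDegree a))) /
            toK (hermitePoly (seedSign a) (seedDegree a)) := by
        rw [tauLogDeriv, tauPoly_one, sum_append_one]
        simp
      rw [h0, h2, sub_zero, map_zero, mul_zero, sub_zero]
      exact hermite_riccati a
  | succ n ih =>
    intro e he
    obtain ⟨e₀, a, rfl, he₀, ha⟩ : ∃ (e₀ : Fin n → ℤ) (a : ℤ), e = Fin.append e₀ ![a] ∧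
        Function.Injective e₀ ∧ a ∉ Set.range e₀ := by
      refine ⟨e ∘ Fin.castSucc, e (Fin.last n), (append_castSucc_last e).symm,
        he.comp (Fin.castSucc_injective n), ?_⟩
      rintro ⟨i, hi⟩
      exact (Fin.castSucc_lt_last i).ne (he hi)
    obtain ⟨h0, hall⟩ := ih e₀ he₀
    obtain ⟨hτa, hRa⟩ := hall a ha
    refine ⟨hτa, fun b hb => ?_⟩
    have hb0 : b ∉ Set.range e₀ := by
      rintro ⟨i, rfl⟩
      exact hb ⟨Fin.castAdd 1 i, by simp⟩
    have hba : a ≠ b := by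
      rintro rfl
      exact hb ⟨Fin.natAdd n 0, by simp⟩
    obtain ⟨hτb, hRb⟩ := hall b hb0
    have hne : tauLogDeriv (Fin.append e₀ ![b]) - tauLogDeriv (Fin.append e₀ ![a]) ≠ 0 := by
      intro h
      rw [sub_eq_zero.1 h, hRa] at hRb
      exact hba (seedEigenvalue_injective (by linear_combination -hRb))
    have hab : tauPoly (Fin.append e₀ ![a, b]) ≠ 0 := by
      intro h
      have key := tauLogDeriv_sub_mul e₀ a b h0 hτa hτb
      rw [h, map_zero, mul_zero] at key
      exact mul_ne_zero hne (mul_ne_zero (toK_ne_zero hτa) (toK_ne_zero hτb)) key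
    rw [append_append]
    exact ⟨hab, (Riccati.darboux DK (ddX_algebraMap_const _) (ddX_algebraMap_const _) hRa hRb hne
      (deriv_logDeriv_eq e₀ a b h0 hτa hτb hab)).2⟩

theorem tau_exchange {n : ℕ} {e : Fin n → ℤ} (he : Function.Injective e) {a b : ℤ}
    (ha : a ∉ Set.range e) (hb : b ∉ Set.range e) (hab : a ≠ b) :
    (tauLogDeriv (Fin.append e ![a, b]) - tauLogDeriv e) *
        (tauLogDeriv (Fin.append e ![b]) - tauLogDeriv (Fin.append e ![a])) =
      seedEigenvalue a - seedEigenvalue b := by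
  obtain ⟨h0, hall⟩ := tauPoly_ne_zero_and_riccati n e he
  obtain ⟨hτa, hRa⟩ := hall a ha
  obtain ⟨hτb, hRb⟩ := hall b hb
  have hne : tauLogDeriv (Fin.append e ![b]) - tauLogDeriv (Fin.append e ![a]) ≠ 0 := by
    intro h
    rw [sub_eq_zero.1 h, hRa] at hRb
    exact hab (seedEigenvalue_injective (by linear_combination -hRb))
  have hτ : tauPoly (Fin.append e ![a, b]) ≠ 0 := by
    have hb' : b ∉ Set.range (Fin.append e ![a]) := by
      rw [Fin.append_right_eq_snoc, Fin.range_snoc]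
      rintro (h | h)
      · exact hab h.symm
      · exact hb h
    rw [← append_append]
    exact ((tauPoly_ne_zero_and_riccati _ _ (injective_append_one he ha)).2 b hb').1
  exact (Riccati.darboux DK (ddX_algebraMap_const _) (ddX_algebraMap_const _) hRa hRb hne
    (deriv_logDeriv_eq e a b h0 hτa hτb hτ)).1

/-- The logarithmic derivative of the Wronskian of the seeds with indices in `S`. -/
noncomputable def tauLogDerivSet (S : Finset ℤ) : RatFunc ℂ :=
  tauLogDeriv (S.orderEmbOfFin rfl)

theorem tauLogDeriv_comp_perm {n : ℕ} (e : Fin n → ℤ) (σ : Equiv.Perm (Fin n)) :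
    tauLogDeriv (e ∘ σ) = tauLogDeriv e := by
  have hs : ∑ i, seedSign ((e ∘ σ) i) = ∑ i, seedSign (e i) :=
    Equiv.sum_comp σ fun i => seedSign (e i)
  have hτ : tauPoly (e ∘ σ) = Equiv.Perm.sign σ * tauPoly e := wdet_comp_perm _ _ _
  rw [tauLogDeriv, tauLogDeriv, hs, hτ]
  rcases Int.units_eq_one_or (Equiv.Perm.sign σ) with h | h <;> simp [h]

/-- A permutation of the seeds only changes the sign of their Wronskian, so that any enumeration
of `S` computes the logarithmic derivative. -/
theorem tauLogDerivSet_eq {n : ℕ} {e : Fin n → ℤ} (he : Function.Injective e) {S : Finset ℤ}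
    (hS : ∀ x, x ∈ S ↔ x ∈ Set.range e) : tauLogDerivSet S = tauLogDeriv e := by
  obtain rfl : n = S.card := by
    have : S = Finset.univ.image e := by
      ext x
      simp [hS]
    rw [this, Finset.card_image_of_injective _ he, Finset.card_univ, Fintype.card_fin]
  have hr : Set.range (S.orderEmbOfFin rfl) = Set.range e := by
    ext x
    rw [Finset.range_orderEmbOfFin, Finset.mem_coe, hS]
  let σ := (Equiv.ofInjective _ (S.orderEmbOfFin rfl).injective).trans
    ((Equiv.setCongr hr).trans (Equiv.ofInjective e he).symm)
  have hσ : (S.orderEmbOfFin rfl : Fin S.card → ℤ) = e ∘ σ := by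
    ext i
    have := Equiv.apply_ofInjective_symm he
      ((Equiv.setCongr hr) ((Equiv.ofInjective _ (S.orderEmbOfFin rfl).injective) i))
    exact this.symm
  rw [tauLogDerivSet, hσ, tauLogDeriv_comp_perm]

theorem tauLogDerivSet_append_one {n : ℕ} {e : Fin n → ℤ} (he : Function.Injective e)
    {S : Finset ℤ} (hS : ∀ x, x ∈ S ↔ x ∈ Set.range e) {a : ℤ} (ha : a ∉ S) :
    tauLogDerivSet (insert a S) = tauLogDeriv (Fin.append e ![a]) := by
  refine tauLogDerivSet_eq (injective_append_one he (by rwa [← hS])) fun x => ?_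
  rw [Fin.append_right_eq_snoc, Fin.range_snoc, Finset.mem_insert, hS]
  rfl

theorem exists_enumeration (S : Finset ℤ) : ∃ (n : ℕ) (e : Fin n → ℤ), Function.Injective e ∧
    ∀ x, x ∈ S ↔ x ∈ Set.range e :=
  ⟨S.card, S.orderEmbOfFin rfl, (S.orderEmbOfFin rfl).injective, fun x => by simp⟩

theorem tauLogDerivSet_riccati (S : Finset ℤ) (m : ℤ) :
    DK (tauLogDerivSet (flipSet S m) - tauLogDerivSet S) +
        (tauLogDerivSet (flipSet S m) - tauLogDerivSet S) ^ 2 =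
      toK (X ^ 2) - 2 * DK (tauLogDerivSet S) - seedEigenvalue m := by
  have key : ∀ S : Finset ℤ, m ∉ S → DK (tauLogDerivSet (insert m S) - tauLogDerivSet S) +
        (tauLogDerivSet (insert m S) - tauLogDerivSet S) ^ 2 =
      toK (X ^ 2) - 2 * DK (tauLogDerivSet S) - seedEigenvalue m := by
    intro S hm
    obtain ⟨n, e, he, hS⟩ := exists_enumeration S
    rw [tauLogDerivSet_append_one he hS hm, tauLogDerivSet_eq he hS]
    exact ((tauPoly_ne_zero_and_riccati n e he).2 m (by rwa [← hS])).2
  by_cases hm : m ∈ S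
  · have h := key (flipSet S m) (by rwa [mem_flipSet_self, not_not])
    rw [← flipSet_of_notMem (by rwa [mem_flipSet_self, not_not]), flipSet_flipSet] at h
    simp only [map_sub] at h ⊢
    linear_combination h
  · rw [flipSet_of_notMem hm]
    exact key S hm

theorem tauLogDerivSet_exchange (S : Finset ℤ) (j m : ℤ) (hjm : j ≠ m) :
    (tauLogDerivSet (flipSet (flipSet S j) m) - tauLogDerivSet S) *
        (tauLogDerivSet (flipSet S m) - tauLogDerivSet (flipSet S j)) =
      seedEigenvalue j - seedEigenvalue m := by
  have key : ∀ S : Finset ℤ, j ∉ S → m ∉ S →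
      (tauLogDerivSet (flipSet (flipSet S j) m) - tauLogDerivSet S) *
        (tauLogDerivSet (flipSet S m) - tauLogDerivSet (flipSet S j)) =
      seedEigenvalue j - seedEigenvalue m := by
    intro S hj hm
    obtain ⟨n, e, he, hS⟩ := exists_enumeration S
    have hj' : j ∉ Set.range e := by rwa [← hS]
    have hm' : m ∉ Set.range e := by rwa [← hS]
    have hmj : m ∉ insert j S := by
      rw [Finset.mem_insert]
      rintro (h | h)
      exacts [hjm h.symm, hm h]
    rw [flipSet_of_notMem hj, flipSet_of_notMem hm, flipSet_of_notMem hmj,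
      tauLogDerivSet_append_one he hS hj, tauLogDerivSet_append_one he hS hm,
      tauLogDerivSet_eq he hS,
      tauLogDerivSet_append_one (injective_append_one he hj') (fun x => ?_) hmj, append_append]
    · exact tau_exchange he hj' hm' hjm
    · rw [Fin.append_right_eq_snoc, Fin.range_snoc, Finset.mem_insert, hS]
      rfl
  -- the identity is invariant, up to the order of its terms, under the flips at `j` and `m`
  by_cases hj : j ∈ S <;> by_cases hm : m ∈ S
  · have h := key (flipSet (flipSet S j) m)
      (by rwa [mem_flipSet_of_ne hjm, mem_flipSet_self, not_not])
      (by rwa [mem_flipSet_self, mem_flipSet_of_ne hjm.symm, not_not])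
    rw [flipSet_flipSet, flipSet_comm (flipSet S j) m j, flipSet_flipSet, flipSet_flipSet] at h
    linear_combination h
  · have h := key (flipSet S j) (by rwa [mem_flipSet_self, not_not])
      (by rwa [mem_flipSet_of_ne hjm.symm])
    rw [flipSet_flipSet] at h
    linear_combination h
  · have h := key (flipSet S m) (by rwa [mem_flipSet_of_ne hjm])
      (by rwa [mem_flipSet_self, not_not])
    rw [flipSet_flipSet, flipSet_comm S m j, flipSet_flipSet] at h
    linear_combination h
  · exact key S hj hm

/-- The Darboux system of the harmonic oscillator `-D² + X²` with eigenvalues `2 m + 1`. -/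
noncomputable def hermiteSystem : DarbouxSystem DK (toK (X ^ 2)) seedEigenvalue where
  u := tauLogDerivSet
  lam_injective := seedEigenvalue_injective
  deriv_lam _ := ddX_algebraMap_const _
  riccati := tauLogDerivSet_riccati
  exchange := tauLogDerivSet_exchange

theorem hermiteSystem_u_empty : hermiteSystem.u ∅ = 0 := by
  change tauLogDerivSet ∅ = 0
  rw [tauLogDerivSet_eq (e := ![]) (fun i => i.elim0) (by simp)]
  have h1 : tauPoly (![] : Fin 0 → ℤ) = 1 := wdet_zero _ _
  simp [tauLogDeriv, h1]

theorem hermiteSystem_v_empty (m : ℤ) : hermiteSystem.v ∅ m = toK (C (seedSign m) * X) +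
    DK (toK (hermitePoly (seedSign m) (seedDegree m))) /
      toK (hermitePoly (seedSign m) (seedDegree m)) := by
  rw [DarbouxSystem.v, hermiteSystem_u_empty, sub_zero, flipSet_of_notMem (Finset.notMem_empty m)]
  change tauLogDerivSet _ = _
  rw [tauLogDerivSet_append_one (e := ![]) (fun i => i.elim0) (by simp) (Finset.notMem_empty m),
    tauLogDeriv, tauPoly_one, sum_append_one]
  simp

/-! ### Rational solutions for the harmonic oscillator -/

/-- Comparison of leading coefficients in the Hermite equation. -/
theorem natDegree_eq_of_hermite_ode {ε μ : ℂ} {B : ℂ[X]} (hB : B ≠ 0)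
    (h : derivative (derivative B) + 2 * C ε * X * derivative B = C μ * B) :
    μ = 2 * ε * B.natDegree := by
  have hlc : B.coeff B.natDegree ≠ 0 := by simpa using hB
  have h1 := congrArg (fun p => coeff p B.natDegree) h
  have h2 : (derivative (derivative B)).coeff B.natDegree = 0 := by
    rw [coeff_derivative, coeff_derivative, coeff_eq_zero_of_natDegree_lt (by omega)]
    simp
  have h3 : (X * derivative B).coeff B.natDegree = B.natDegree * B.coeff B.natDegree := by
    rcases Nat.eq_zero_or_pos B.natDegree with h0 | h0
    · rw [h0]
      simp
    · obtain ⟨n, hn⟩ : ∃ n, B.natDegree = n + 1 := ⟨B.natDegree - 1, by omega⟩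
      rw [hn, coeff_X_mul, coeff_derivative]
      push_cast
      ring
  have h4 : 2 * C ε * X * derivative B = C (2 * ε) * (X * derivative B) := by
    rw [C_mul, C_ofNat]
    ring
  simp only [h4, coeff_add, h2, coeff_C_mul, h3] at h1
  apply mul_right_cancel₀ hlc
  linear_combination -h1

/-- A polynomial solution of the Hermite equation is a multiple of the Hermite polynomial of the
same degree: otherwise a linear combination of the two would be a nonzero solution of smaller
degree. -/
theorem eq_C_mul_hermitePoly {ε : ℂ} {B : ℂ[X]} (hε : ε ^ 2 = 1)
    (h : derivative (derivative B) + 2 * C ε * X * derivative B =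
      C (2 * ε * B.natDegree) * B) :
    ∃ c : ℂ, B = C c * hermitePoly ε B.natDegree := by
  obtain ⟨n, hn⟩ : ∃ n, n = B.natDegree := ⟨_, rfl⟩
  rw [← hn] at h ⊢
  obtain ⟨c, hc⟩ : ∃ c, c = B.coeff n / 2 ^ n := ⟨_, rfl⟩
  refine ⟨c, ?_⟩
  by_contra hne
  have hne' : B - C c * hermitePoly ε n ≠ 0 := sub_ne_zero.2 hne
  have hε0 : ε ≠ 0 := by
    rintro rfl
    norm_num at hε
  have hC : C ε ^ 2 = 1 := by rw [← C_pow, hε, C_1]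
  have hode := hermitePoly_ode ε n
  have h5 := natDegree_eq_of_hermite_ode (ε := ε) (μ := 2 * ε * n) hne' (by
    simp only [derivative_sub, derivative_mul, derivative_C, zero_mul, zero_add, C_mul, C_ofNat,
      map_natCast] at h ⊢
    linear_combination h - C c * C ε * hode +
      C c * (derivative (derivative (hermitePoly ε n))) * hC)
  have h6 : n = (B - C c * hermitePoly ε n).natDegree := by
    have : (n : ℂ) = ((B - C c * hermitePoly ε n).natDegree : ℂ) := by
      apply mul_left_cancel₀ (mul_ne_zero two_ne_zero hε0)
      exact h5
    exact_mod_cast this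
  have h7 : (B - C c * hermitePoly ε n).coeff n = 0 := by
    rw [coeff_sub, coeff_C_mul, hermitePoly_coeff_self, hc,
      div_mul_cancel₀ _ (pow_ne_zero n two_ne_zero), sub_self]
  exact hne' (leadingCoeff_eq_zero.1 (by rwa [leadingCoeff, ← h6]))

/-- If `B'' + 2 Q B' + (Q' + Q² - X² + l) B = 0` with `B ≠ 0`, then `Q = ± X`: the degree of
`Q' + Q² - X² + l` is less than that of `Q`. -/
theorem eq_X_or_neg_X_of_ode {B Q : ℂ[X]} (hB : B ≠ 0) (l : ℂ)
    (h : derivative (derivative B) + 2 * Q * derivative B +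
      (derivative Q + Q ^ 2 - X ^ 2 + C l) * B = 0) : ∃ ε : ℂ, ε ^ 2 = 1 ∧ Q = C ε * X := by
  have hb : B.coeff B.natDegree ≠ 0 := by simpa using hB
  obtain ⟨b, hbd⟩ : ∃ b, b = B.natDegree := ⟨_, rfl⟩
  obtain ⟨q, hq⟩ : ∃ q, q = Q.natDegree := ⟨_, rfl⟩
  rw [← hbd] at hb
  have hlow : ∀ n, q + b ≤ n →
      (derivative (derivative B) + 2 * Q * derivative B).coeff n = 0 := by
    intro n hn
    rcases Nat.eq_zero_or_pos b with h0 | h0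
    · rw [derivative_of_natDegree_zero (hbd.symm.trans h0)]
      simp
    · have hB1 : (derivative B).natDegree ≤ b - 1 := by
        rw [hbd]
        exact natDegree_derivative_le B
      have hB2 : (derivative (derivative B)).natDegree ≤ b - 1 - 1 :=
        (natDegree_derivative_le _).trans (Nat.sub_le_sub_right hB1 1)
      have hQB : (Q * derivative B).natDegree ≤ q + (b - 1) :=
        natDegree_mul_le.trans (by omega)
      rw [coeff_add, mul_assoc, ← C_ofNat, coeff_C_mul, coeff_eq_zero_of_natDegree_lt (by omega),
        coeff_eq_zero_of_natDegree_lt (p := Q * derivative B) (by omega)]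
      simp
  have hhigh : ∀ n, q ≤ n → (derivative Q + Q ^ 2 - X ^ 2 + C l).natDegree ≤ n →
      (derivative Q + Q ^ 2 - X ^ 2 + C l).coeff n = 0 := by
    intro n hn hE
    have h1 := congrArg (fun p => coeff p (n + b)) h
    simp only [coeff_add _ _ (n + b)] at h1
    rw [← coeff_add, hlow _ (by omega), zero_add, coeff_mul_add_eq_of_natDegree_le hE hbd.symm.le,
      coeff_zero] at h1
    exact (mul_eq_zero.1 h1).resolve_right hb
  have hE : q ≤ 1 := by
    by_contra! hq2
    have hQ' : (derivative Q).natDegree ≤ q - 1 := by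
      rw [hq]
      exact natDegree_derivative_le Q
    have hQ2 : (Q ^ 2).natDegree ≤ 2 * q := by
      rw [hq]
      exact natDegree_pow_le
    have h1 := hhigh (2 * q) (by omega) (by
      refine natDegree_add_le_of_degree_le ((natDegree_sub_le_of_le
        (natDegree_add_le_of_degree_le (hQ'.trans (by omega)) hQ2) ?_).trans (max_self _).le) ?_
      · rw [natDegree_X_pow]
        omega
      · rw [natDegree_C]
        omega)
    rw [coeff_add, coeff_sub, coeff_add, coeff_eq_zero_of_natDegree_lt (by omega), coeff_X_pow,
      if_neg (by omega), coeff_C, if_neg (by omega), coeff_pow_of_natDegree_le hq.symm.le, zero_add,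
      sub_zero, add_zero] at h1
    have h2 : Q.leadingCoeff = 0 := by
      rw [leadingCoeff, ← hq]
      exact pow_eq_zero_iff two_ne_zero |>.1 h1
    rw [leadingCoeff_eq_zero.1 h2, natDegree_zero] at hq
    omega
  obtain ⟨s, t, rfl⟩ := exists_eq_X_add_C_of_natDegree_le_one (hq ▸ hE)
  have hexp : derivative (C s * X + C t) + (C s * X + C t) ^ 2 - X ^ 2 + C l =
      C (s ^ 2 - 1) * X ^ 2 + C (2 * s * t) * X + C (s + t ^ 2 + l) := by
    simp only [derivative_add, derivative_mul, derivative_C, derivative_X, C_add, C_sub, C_mul,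
      C_pow, C_1, C_ofNat]
    ring
  rw [hexp] at hhigh
  have hc2 : ∀ x y z : ℂ, (C x * X ^ 2 + C y * X + C z).coeff 2 = x := by
    simp
  have hc1 : ∀ y z : ℂ, (C y * X + C z).coeff 1 = y := by
    simp [coeff_C]
  have hs : s ^ 2 - 1 = 0 := by
    rw [← hhigh 2 (by omega) natDegree_quadratic_le, hc2]
  have ht : 2 * s * t = 0 := by
    rw [hs, C_0, zero_mul, zero_add] at hhigh
    rw [← hhigh 1 hE natDegree_linear_le, hc1]
  have hs0 : s ≠ 0 := by
    rintro rfl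
    norm_num at hs
  have ht0 : t = 0 := by simpa [hs0] using ht
  exact ⟨s, sub_eq_zero.1 hs, by rw [ht0, C_0, add_zero]⟩

/-- If `Dz + p z` is a polynomial, with `p` a polynomial, then so is `z`: at a pole of `z` the
derivative has a pole of higher order. -/
theorem exists_polynomial_of_linear_ode {z : RatFunc ℂ} {p r : ℂ[X]}
    (h : DK z + toK p * z = toK r) : ∃ A : ℂ[X], z = toK A := by
  have hd := toK_ne_zero z.denom_ne_zero
  have h1 : derivative z.num * z.denom - z.num * derivative z.denom + p * z.num * z.denom =
      r * z.denom ^ 2 := by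
    apply IsFractionRing.injective ℂ[X] (RatFunc ℂ)
    rw [← z.num_div_denom, RatFunc.ddX_div _ _ z.denom_ne_zero, z.num_div_denom] at h
    have hz : z = toK z.num / toK z.denom := z.num_div_denom.symm
    obtain ⟨A, hA⟩ : ∃ A, A = z.num := ⟨_, rfl⟩
    obtain ⟨B, hB⟩ : ∃ B, B = z.denom := ⟨_, rfl⟩
    rw [← hA, ← hB] at hz h ⊢
    rw [← hB] at hd
    rw [hz] at h
    field_simp at h
    simp only [map_add, map_sub, map_mul, map_pow] at h ⊢
    linear_combination h
  have hdvd : z.denom ∣ z.num * derivative z.denom :=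
    ⟨derivative z.num + p * z.num - r * z.denom, by linear_combination -h1⟩
  have hdvd' := z.isCoprime_num_denom.symm.dvd_of_dvd_mul_left hdvd
  have hdeg : z.denom.natDegree = 0 := by
    by_contra hne
    exact absurd (natDegree_le_of_dvd hdvd' (fun h0 => hne (derivative_eq_zero.1
      h0))) (not_le.2 (natDegree_derivative_lt hne))
  have h1 : z.denom = 1 := (RatFunc.monic_denom z).natDegree_eq_zero.1 hdeg
  refine ⟨z.num, ?_⟩
  conv_lhs => rw [← z.num_div_denom, h1, map_one, div_one]

/-- The rational solutions of `R' + R² = X² - l` are the logarithmic derivatives of the seeds. -/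
theorem hermiteSystem_riccatiComplete_empty : hermiteSystem.RiccatiComplete ∅ := by
  intro R l hR
  rw [hermiteSystem_u_empty, map_zero, mul_zero, sub_zero, algebraMap_const_eq] at hR
  obtain ⟨A, hA⟩ : ∃ A, A = R.num := ⟨_, rfl⟩
  obtain ⟨B, hB⟩ : ∃ B, B = R.denom := ⟨_, rfl⟩
  have hAB : IsCoprime A B := by
    rw [hA, hB]
    exact R.isCoprime_num_denom
  have hB0 : B ≠ 0 := by
    rw [hB]
    exact R.denom_ne_zero
  have hR' : R = toK A / toK B := by rw [hA, hB, R.num_div_denom]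
  have hBK := toK_ne_zero hB0
  have h1 : derivative A * B - A * derivative B + A ^ 2 = (X ^ 2 - C l) * B ^ 2 := by
    apply IsFractionRing.injective ℂ[X] (RatFunc ℂ)
    rw [hR', RatFunc.ddX_div _ _ hB0] at hR
    field_simp at hR
    simp only [map_add, map_sub, map_mul, map_pow] at hR ⊢
    linear_combination hR
  obtain ⟨Q, hQ⟩ : B ∣ A - derivative B := by
    refine hAB.symm.dvd_of_dvd_mul_left ⟨(X ^ 2 - C l) * B - derivative A, ?_⟩
    linear_combination h1
  obtain rfl : A = derivative B + B * Q := by linear_combination hQ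
  have h2 : derivative (derivative B) + 2 * Q * derivative B +
      (derivative Q + Q ^ 2 - X ^ 2 + C l) * B = 0 := by
    apply mul_left_cancel₀ hB0
    simp only [derivative_add, derivative_mul] at h1
    linear_combination h1
  obtain ⟨ε, hε, rfl⟩ := eq_X_or_neg_X_of_ode hB0 l h2
  have hC : C ε ^ 2 = 1 := by rw [← C_pow, hε, C_1]
  have h3 : derivative (derivative B) + 2 * C ε * X * derivative B = C (-(ε + l)) * B := by
    simp only [derivative_mul, derivative_C, derivative_X] at h2
    rw [C_neg, C_add]
    linear_combination h2 - X ^ 2 * B * hC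
  have hμ := natDegree_eq_of_hermite_ode hB0 h3
  rw [hμ] at h3
  obtain ⟨c, hc⟩ := eq_C_mul_hermitePoly hε h3
  obtain ⟨m, hm, hmd⟩ : ∃ m, seedSign m = ε ∧ seedDegree m = B.natDegree := by
    rcases mul_self_eq_one_iff.1 ((pow_two ε).symm.trans hε) with rfl | rfl
    · refine ⟨-(B.natDegree : ℤ) - 1, ?_, ?_⟩
      · rw [seedSign, if_pos (by omega)]
      · rw [seedDegree, if_pos (by omega)]
        omega
    · refine ⟨B.natDegree, ?_, ?_⟩
      · rw [seedSign, if_neg (by omega)]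
      · rw [seedDegree, if_neg (by omega)]
        omega
  refine ⟨m, ?_, ?_⟩
  · have hl : l = -ε * (2 * (B.natDegree : ℂ) + 1) := by linear_combination -hμ
    rw [seedEigenvalue, ← seed_eigenvalue, hm, hmd, hl]
  · rw [hermiteSystem_v_empty, hm, hmd, RatFunc.ddX_algebraMap, hR']
    have hc0 : toK (C c) ≠ 0 := by
      refine toK_ne_zero fun h0 => hB0 ?_
      rw [hc, h0, zero_mul]
    have hH := toK_ne_zero (hermitePoly_ne_zero ε B.natDegree)
    have hBc := congrArg toK hc
    have hBd := congrArg toK (congrArg derivative hc)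
    rw [derivative_mul, derivative_C, zero_mul, zero_add, map_mul] at hBd
    rw [map_mul] at hBc
    rw [map_add, map_mul toK B, add_div, mul_div_cancel_left₀ _ hBK, hBd]
    rw [hBc, mul_div_mul_left _ _ hc0, add_comm]

/-- Repeated integration by parts: modulo the image of `Λ = D + 2 ε X`, multiplication by the
`n`-th Hermite polynomial is, up to sign, the `n`-th derivative. -/
theorem hermitePoly_mul_eq {ε : ℂ} (hε : ε ^ 2 = 1) (n : ℕ) : ∀ q : ℂ[X], ∃ z : ℂ[X],
    hermitePoly ε n * q = derivative z + 2 * C ε * X * z +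
      C ((-ε) ^ n) * derivative^[n] q := by
  have hC : C ε ^ 2 = 1 := by rw [← C_pow, hε, C_1]
  induction n with
  | zero => exact fun q => ⟨0, by simp [hermitePoly]⟩
  | succ n ih =>
    intro q
    obtain ⟨z, hz⟩ := ih (derivative q)
    refine ⟨C ε * hermitePoly ε n * q - C ε * z, ?_⟩
    rw [Function.iterate_succ_apply, hermitePoly_succ, pow_succ, C_mul, C_neg]
    simp only [derivative_sub, derivative_mul, derivative_C]
    linear_combination -2 * X * hermitePoly ε n * q * hC - C ε * hz

theorem iterate_derivative_hermitePoly (ε : ℂ) (n : ℕ) :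
    derivative^[n] (hermitePoly ε n) = C (2 ^ n * (n.factorial : ℂ)) := by
  induction n with
  | zero => simp [hermitePoly]
  | succ n ih =>
    have h : (2 * ((n : ℂ[X]) + 1)) = C (2 * ((n : ℂ) + 1)) := by
      simp only [C_mul, C_add, C_1, map_natCast, C_ofNat]
    rw [Function.iterate_succ_apply, derivative_hermitePoly_succ, h, iterate_derivative_C_mul, ih,
      ← C_mul, Nat.factorial_succ]
    congr 1
    push_cast
    ring

/-- For a seed `ψ = exp (ε X² / 2) G` of the harmonic oscillator, `y ψ²` being an antiderivative of
`ψ²` means that `z = y G²` satisfies `z' + 2 ε X z = G²`. -/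
theorem hermiteSystem_nonExact_empty (m : ℤ) : hermiteSystem.NonExact ∅ m := by
  intro y hy
  rw [hermiteSystem_v_empty] at hy
  have hε := seedSign_sq m
  generalize seedSign m = ε at hy hε
  generalize seedDegree m = n at hy
  have hG := toK_ne_zero (hermitePoly_ne_zero ε n)
  have hz : DK (y * toK (hermitePoly ε n) ^ 2) + toK (2 * C ε * X) * (y * toK (hermitePoly ε n) ^ 2)
      = toK (hermitePoly ε n ^ 2) := by
    rw [pow_two, Riccati.deriv_mul, Riccati.deriv_mul]
    field_simp at hy
    simp only [map_mul, map_pow, map_ofNat] at hy ⊢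
    linear_combination toK (hermitePoly ε n) * hy
  obtain ⟨A, hA⟩ := exists_polynomial_of_linear_ode hz
  rw [hA, RatFunc.ddX_algebraMap, ← map_mul, ← map_add] at hz
  have hz' := IsFractionRing.injective ℂ[X] (RatFunc ℂ) hz
  obtain ⟨z, hz2⟩ := hermitePoly_mul_eq hε n (hermitePoly ε n)
  rw [iterate_derivative_hermitePoly, ← C_mul] at hz2
  have hε0 : ε ≠ 0 := by
    rintro rfl
    norm_num at hε
  obtain ⟨c, hc⟩ : ∃ c : ℂ, c = (-ε) ^ n * (2 ^ n * (n.factorial : ℂ)) := ⟨_, rfl⟩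
  have hc0 : c ≠ 0 := by
    rw [hc]
    exact mul_ne_zero (pow_ne_zero _ (neg_ne_zero.2 hε0)) (mul_ne_zero (pow_ne_zero _ two_ne_zero)
      (Nat.cast_ne_zero.2 n.factorial_ne_zero))
  rw [← hc] at hz2
  -- a nonzero constant is not in the image of `D + 2 ε X`, which raises degrees by one
  obtain ⟨w, hw⟩ : ∃ w, w = A - z := ⟨_, rfl⟩
  have hw1 : derivative w + C (2 * ε) * (X * w) = C c := by
    rw [hw, derivative_sub, C_mul, C_ofNat]
    linear_combination hz' + hz2
  have hw2 := congrArg (fun p => coeff p (w.natDegree + 1)) hw1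
  simp only [coeff_add, coeff_C_mul, coeff_X_mul, coeff_C_succ] at hw2
  rw [coeff_eq_zero_of_natDegree_lt ((natDegree_derivative_le w).trans_lt (by omega)), zero_add,
    mul_eq_zero, or_iff_right (mul_ne_zero two_ne_zero hε0)] at hw2
  have hw3 : w = 0 := leadingCoeff_eq_zero.1 hw2
  rw [hw3, derivative_zero, mul_zero, mul_zero, add_zero] at hw1
  exact hc0 (C_eq_zero.1 hw1.symm)

/-- The seed of index `m` for `{m}` is the reciprocal of a seed `ψ` of the harmonic oscillator. An
antiderivative of `ψ⁻²` would provide a second rational Riccati solution for the same eigenvalue. -/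
theorem hermiteSystem_nonExact_singleton (m : ℤ) : hermiteSystem.NonExact {m} m := by
  intro y hy
  have hs : ({m} : Finset ℤ) = flipSet ∅ m := by
    rw [flipSet_of_notMem (Finset.notMem_empty m)]
    rfl
  rw [hs, DarbouxSystem.v_flipSet_self] at hy
  have hy0 : y ≠ 0 := by
    rintro rfl
    simp at hy
  have hv := hermiteSystem.riccati_v ∅ m
  obtain ⟨n, hn, hR⟩ := hermiteSystem_riccatiComplete_empty (hermiteSystem.v ∅ m + y⁻¹)
    (2 * (m : ℂ) + 1) (by
      rw [← seedEigenvalue, ← hv, map_add, Riccati.deriv_inv]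
      field_simp
      linear_combination -hy)
  obtain rfl := seedEigenvalue_injective hn
  exact inv_ne_zero hy0 (by linear_combination hR)

theorem hermiteSystem_nonExact (S : Finset ℤ) (m : ℤ) : hermiteSystem.NonExact S m := by
  have key : ∀ (T : Finset ℤ) (S₀ : Finset ℤ), m ∉ T → Disjoint T S₀ →
      hermiteSystem.NonExact S₀ m → hermiteSystem.NonExact (T ∪ S₀) m := by
    intro T S₀
    induction T using Finset.induction_on with
    | empty => intro _ _ h; simpa using h
    | insert j T hj ih =>
      intro hm hd h
      rw [Finset.mem_insert, not_or] at hm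
      rw [Finset.disjoint_insert_left] at hd
      rw [Finset.insert_union, ← flipSet_of_notMem (by simp [hj, hd.1])]
      exact DarbouxSystem.NonExact.flipSet _ (Ne.symm hm.1) (ih hm.2 hd.2 h)
  by_cases hm : m ∈ S
  · have h := key (S.erase m) {m} (Finset.notMem_erase m S) (by simp)
      (hermiteSystem_nonExact_singleton m)
    rwa [Finset.union_comm, ← Finset.insert_eq, Finset.insert_erase hm] at h
  · simpa using key S ∅ hm (by simp) (hermiteSystem_nonExact_empty m)

theorem hermiteSystem_riccatiComplete (S : Finset ℤ) : hermiteSystem.RiccatiComplete S := by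
  induction S using Finset.induction_on with
  | empty => exact hermiteSystem_riccatiComplete_empty
  | insert j S hj ih =>
    rw [← flipSet_of_notMem hj]
    exact ih.flipSet _ (hermiteSystem_nonExact S j)

/-! ### Pseudo-Wronskians as polynomials -/

theorem hasDerivAt_exp_mul_eval (c : ℂ) (p : ℂ[X]) (z : ℂ) :
    HasDerivAt (fun w => Complex.exp (c / 2 * w ^ 2) * p.eval w)
      (Complex.exp (c / 2 * z ^ 2) * (derivative p + C c * X * p).eval z) z := by
  have h1 : HasDerivAt (fun w : ℂ => c / 2 * w ^ 2) (c / 2 * (2 * z)) z := by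
    simpa using (hasDerivAt_pow 2 z).const_mul (c / 2)
  refine (h1.cexp.mul (p.hasDerivAt z)).congr_deriv ?_
  simp only [eval_add, eval_mul, eval_C, eval_X]
  ring

theorem iteratedDeriv_exp_mul_hermite (n : ℕ) :
    iteratedDeriv n (fun w : ℂ => Complex.exp (-w ^ 2)) =
      fun z => Complex.exp (-2 / 2 * z ^ 2) * (C ((-1) ^ n) * hermitePoly (-1) n).eval z := by
  induction n with
  | zero =>
    ext z
    simp [hermitePoly]
  | succ n ih =>
    rw [iteratedDeriv_succ, ih]
    ext z
    rw [(hasDerivAt_exp_mul_eval (-2) _ z).deriv, hermitePoly_succ]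
    congr 2
    simp only [derivative_C_mul, pow_succ, C_mul, C_neg, C_1, C_ofNat]
    ring

theorem hermiteFun_eq (n : ℕ) (z : ℂ) : hermiteFun n z = (hermitePoly (-1) n).eval z := by
  rw [hermiteFun, iteratedDeriv_exp_mul_hermite]
  have h1 : Complex.exp (z ^ 2) * Complex.exp (-2 / 2 * z ^ 2) = 1 := by
    rw [← Complex.exp_add]
    simp
  have h2 : ((-1 : ℂ) ^ n) * (-1) ^ n = 1 := by rw [← mul_pow]; simp
  beta_reduce
  rw [eval_C_mul]
  linear_combination (-1) ^ n * (-1) ^ n * (hermitePoly (-1) n).eval z * h1 +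
    (hermitePoly (-1) n).eval z * h2

theorem hermitePoly_comp_I (n : ℕ) : (hermitePoly (-1) n).comp (C Complex.I * X) =
    C (Complex.I ^ n) * hermitePoly 1 n := by
  have hI : (C Complex.I : ℂ[X]) ^ 2 = -1 := by rw [← C_pow, Complex.I_sq, C_neg, C_1]
  induction n with
  | zero => simp [hermitePoly]
  | succ n ih =>
    have h := congrArg derivative ih
    rw [derivative_comp, derivative_C_mul, derivative_C_mul, derivative_X, mul_one] at h
    rw [hermitePoly_succ, hermitePoly_succ, add_comp, mul_comp, mul_comp, mul_comp, ih, C_comp,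
      X_comp, ofNat_comp, pow_succ, C_mul, C_neg, C_1]
    linear_combination C Complex.I * h -
      (derivative (hermitePoly (-1) n)).comp (C Complex.I * X) * hI

theorem conjHermiteFun_eq (n : ℕ) (z : ℂ) : conjHermiteFun n z = (hermitePoly 1 n).eval z := by
  have h := congrArg (eval z) (hermitePoly_comp_I n)
  rw [eval_comp, eval_C_mul, eval_C_mul, eval_X] at h
  rw [conjHermiteFun, hermiteFun_eq, h, inv_mul_cancel_left₀ (pow_ne_zero n Complex.I_ne_zero)]

theorem iteratedDeriv_gauged_seed (m : ℤ) (j : ℕ) :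
    iteratedDeriv j (fun w => Complex.exp ((1 + seedSign m) / 2 * w ^ 2) * (seedRow m 0).eval w) =
      fun z => Complex.exp ((1 + seedSign m) / 2 * z ^ 2) * (seedRow m j).eval z := by
  induction j with
  | zero => simp
  | succ j ih =>
    rw [iteratedDeriv_succ, ih]
    ext z
    exact (hasDerivAt_exp_mul_eval (1 + seedSign m) _ z).deriv

namespace MayaDiagram

/-- The indices of the seeds in the pseudo-Wronskian of `M`, in increasing order. -/
noncomputable def seedIndex (M : MayaDiagram) : Fin (M.minus.card + M.plus.card) → ℤ :=
  Fin.append (fun i => -(M.frobS i : ℤ) - 1) (fun j => (M.frobT j : ℤ))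

/-- The polynomial whose values are those of the pseudo-Wronskian. -/
noncomputable def pseudoWronskianPoly (M : MayaDiagram) : ℂ[X] := tauPoly M.seedIndex

theorem seedIndex_castAdd (M : MayaDiagram) (i : Fin M.minus.card) :
    M.seedIndex (Fin.castAdd _ i) = -(M.frobS i : ℤ) - 1 := by simp [seedIndex]

theorem seedIndex_natAdd (M : MayaDiagram) (i : Fin M.plus.card) :
    M.seedIndex (Fin.natAdd _ i) = M.frobT i := by simp [seedIndex]

theorem pseudoWronskian_eq (M : MayaDiagram) :
    M.pseudoWronskian = fun z => M.pseudoWronskianPoly.eval z := by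
  ext z
  have hrow : ∀ i, (Fin.append
        (fun i : Fin M.minus.card => fun w : ℂ =>
          Complex.exp (w ^ 2) * conjHermiteFun (M.frobS i) w)
        (fun j : Fin M.plus.card => hermiteFun (M.frobT j))) i =
      fun w => Complex.exp ((1 + seedSign (M.seedIndex i)) / 2 * w ^ 2) *
        (seedRow (M.seedIndex i) 0).eval w := by
    intro i
    ext w
    refine Fin.addCases (fun i => ?_) (fun i => ?_) i
    · rw [Fin.append_left, conjHermiteFun_eq, seedIndex_castAdd, seedRow, seedDegree, seedSign,
        if_pos (by omega), if_pos (by omega)]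
      have : (-(-(M.frobS i : ℤ) - 1) - 1).toNat = M.frobS i := by omega
      rw [this]
      norm_num
    · rw [Fin.append_right, hermiteFun_eq, seedIndex_natAdd, seedRow, seedDegree, seedSign,
        if_neg (by omega), if_neg (by omega), Int.toNat_natCast]
      simp
  have hprod : ∏ i, Complex.exp ((1 + seedSign (M.seedIndex i)) / 2 * z ^ 2) =
      Complex.exp ((M.minus.card : ℂ) * z ^ 2) := by
    rw [Fin.prod_univ_add]
    have h1 : ∀ i, seedSign (M.seedIndex (Fin.castAdd M.plus.card i)) = 1 := fun i => by
      rw [seedIndex_castAdd, seedSign, if_pos (by omega)]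
    have h2 : ∀ i, seedSign (M.seedIndex (Fin.natAdd M.minus.card i)) = -1 := fun i => by
      rw [seedIndex_natAdd, seedSign, if_neg (by omega)]
    simp only [h1, h2]
    rw [← Complex.exp_sum]
    norm_num
  rw [pseudoWronskian, wronskianDet]
  simp only [hrow, iteratedDeriv_gauged_seed]
  have hmul := Matrix.det_mul_column
    (fun i => Complex.exp ((1 + seedSign (M.seedIndex i)) / 2 * z ^ 2))
    (Matrix.of fun i j : Fin (M.minus.card + M.plus.card) => (seedRow (M.seedIndex i) j).eval z)
  simp only [Matrix.of_apply] at hmul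
  rw [hmul, hprod, ← mul_assoc, ← Complex.exp_add, neg_mul, neg_add_cancel, Complex.exp_zero,
    one_mul, pseudoWronskianPoly, tauPoly, wdet, ← coe_evalRingHom, RingHom.map_det]
  rfl

theorem mem_range_seedIndex (M : MayaDiagram) (x : ℤ) :
    x ∈ Set.range M.seedIndex ↔ (x < 0 ∧ x ∉ M.carrier) ∨ (0 ≤ x ∧ x ∈ M.carrier) := by
  have hS : ∀ n, n ∈ M.minus ↔ ∃ i, M.frobS i = n := by
    intro n
    have h := Finset.range_orderEmbOfFin M.minus rfl
    rw [← Finset.mem_coe, ← h]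
    exact ⟨fun ⟨i, hi⟩ => ⟨i.rev, by rw [frobS, Fin.rev_rev, hi]⟩, fun ⟨i, hi⟩ => ⟨i.rev, hi⟩⟩
  have hT : ∀ n, n ∈ M.plus ↔ ∃ i, M.frobT i = n := by
    intro n
    have h := Finset.range_orderEmbOfFin M.plus rfl
    rw [← Finset.mem_coe, ← h]
    rfl
  have hm : ∀ n : ℕ, n ∈ M.minus ↔ -(n : ℤ) - 1 ∉ M.carrier := by simp [minus]
  have hp : ∀ n : ℕ, n ∈ M.plus ↔ (n : ℤ) ∈ M.carrier := by simp [plus]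
  constructor
  · rintro ⟨i, rfl⟩
    refine Fin.addCases (fun i => ?_) (fun i => ?_) i
    · rw [seedIndex_castAdd]
      exact Or.inl ⟨by omega, (hm _).1 ((hS _).2 ⟨i, rfl⟩)⟩
    · rw [seedIndex_natAdd]
      exact Or.inr ⟨by omega, (hp _).1 ((hT _).2 ⟨i, rfl⟩)⟩
  · rintro (⟨h0, hx⟩ | ⟨h0, hx⟩)
    · have hx' : x = -((-x - 1).toNat : ℤ) - 1 := by omega
      obtain ⟨i, hi⟩ := (hS _).1 ((hm (-x - 1).toNat).2 (by rwa [← hx']))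
      exact ⟨Fin.castAdd _ i, by rw [seedIndex_castAdd, hi, ← hx']⟩
    · have hx' : x = (x.toNat : ℤ) := by omega
      obtain ⟨i, hi⟩ := (hT _).1 ((hp x.toNat).2 (by rwa [← hx']))
      exact ⟨Fin.natAdd _ i, by rw [seedIndex_natAdd, hi, ← hx']⟩

theorem seedIndex_injective (M : MayaDiagram) : Function.Injective M.seedIndex := by
  rw [seedIndex, Fin.append_injective_iff]
  refine ⟨fun i j h => ?_, fun i j h => ?_, fun i j h => ?_⟩
  · have h' : M.frobS i = M.frobS j := by
      dsimp only at h
      omega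
    exact Fin.rev_injective ((M.minus.orderEmbOfFin rfl).injective h')
  · have h' : M.frobT i = M.frobT j := by
      dsimp only at h
      omega
    exact (M.plus.orderEmbOfFin rfl).injective h'
  · omega

/-- The set of integers at which `M` differs from the Maya diagram of all negative integers. -/
noncomputable def seedSet (M : MayaDiagram) : Finset ℤ := Finset.univ.image M.seedIndex

theorem mem_seedSet (M : MayaDiagram) (x : ℤ) :
    x ∈ M.seedSet ↔ (x < 0 ∧ x ∉ M.carrier) ∨ (0 ≤ x ∧ x ∈ M.carrier) := by
  rw [← mem_range_seedIndex]
  simp [seedSet]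

theorem seedSet_flip (M : MayaDiagram) (m : ℤ) : (M.flip m).seedSet = flipSet M.seedSet m := by
  ext x
  by_cases hx : x = m
  · subst hx
    rw [mem_flipSet_self, mem_seedSet, mem_seedSet]
    by_cases h : x ∈ M.carrier
    · simp [flip, h]
    · simp [flip, h]
  · rw [mem_flipSet_of_ne hx, mem_seedSet, mem_seedSet]
    by_cases h : m ∈ M.carrier <;> simp [flip, h, hx]

theorem sum_seedSign (M : MayaDiagram) : ∑ i, seedSign (M.seedIndex i) = -(M.index : ℂ) := by
  have h1 : ∀ i, seedSign (M.seedIndex (Fin.castAdd M.plus.card i)) = 1 := fun i => by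
    rw [seedIndex_castAdd, seedSign, if_pos (by omega)]
  have h2 : ∀ i, seedSign (M.seedIndex (Fin.natAdd M.minus.card i)) = -1 := fun i => by
    rw [seedIndex_natAdd, seedSign, if_neg (by omega)]
  rw [Fin.sum_univ_add]
  simp only [h1, h2]
  simp [index, sub_eq_add_neg]

theorem sum_seedSet (M : MayaDiagram) : ∑ x ∈ M.seedSet, seedSign x = -(M.index : ℂ) := by
  rw [seedSet, Finset.sum_image fun a _ b _ h => M.seedIndex_injective h, sum_seedSign]

theorem index_flip (M : MayaDiagram) (m : ℤ) :
    ((M.flip m).index : ℂ) = M.index - M.sign m := by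
  have h1 := M.sum_seedSet
  have h2 := (M.flip m).sum_seedSet
  rw [seedSet_flip] at h2
  by_cases hm : m ∈ M.seedSet
  · have h3 : M.seedSet = insert m (flipSet M.seedSet m) := by
      rw [← flipSet_of_notMem (by rwa [mem_flipSet_self, not_not]), flipSet_flipSet]
    rw [h3, Finset.sum_insert (by rwa [mem_flipSet_self, not_not]), h2] at h1
    have h4 : M.sign m = -seedSign m := by
      rw [mem_seedSet] at hm
      unfold sign seedSign
      rcases hm with ⟨h, h'⟩ | ⟨h, h'⟩
      · simp [h, h']
      · simp [not_lt.2 h, h']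
    linear_combination h4 - h1
  · rw [flipSet_of_notMem hm, Finset.sum_insert hm, h1] at h2
    have h4 : M.sign m = seedSign m := by
      rw [mem_seedSet] at hm
      unfold sign seedSign
      by_cases h : m < 0 <;> by_cases h' : m ∈ M.carrier <;> simp_all
    linear_combination h4 + h2

theorem pseudoWronskianPoly_ne_zero (M : MayaDiagram) : M.pseudoWronskianPoly ≠ 0 :=
  (tauPoly_ne_zero_and_riccati _ _ M.seedIndex_injective).1

theorem hermiteSystem_u_seedSet (M : MayaDiagram) : hermiteSystem.u M.seedSet =
    toK (C (-(M.index : ℂ)) * X) +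
      DK (toK M.pseudoWronskianPoly) / toK M.pseudoWronskianPoly := by
  change tauLogDerivSet _ = _
  rw [tauLogDerivSet_eq M.seedIndex_injective (by simp [seedSet]), tauLogDeriv, sum_seedSign]
  rfl

theorem hermiteSystem_v_seedSet (M : MayaDiagram) (m : ℤ) : hermiteSystem.v M.seedSet m =
    toK (C (M.sign m) * X) +
      DK (toK (M.flip m).pseudoWronskianPoly) / toK (M.flip m).pseudoWronskianPoly -
      DK (toK M.pseudoWronskianPoly) / toK M.pseudoWronskianPoly := by
  rw [DarbouxSystem.v, ← seedSet_flip, hermiteSystem_u_seedSet, hermiteSystem_u_seedSet,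
    index_flip]
  simp only [map_mul, map_neg, map_sub]
  ring

end MayaDiagram

/-! ### Seeds as eigenfunctions -/

theorem ratFunc_eval_div (p q : ℂ[X]) {z : ℂ} (hq : q.eval z ≠ 0) :
    (toK p / toK q).eval (RingHom.id ℂ) z = p.eval z / q.eval z := by
  set f := toK p / toK q with hf
  have hq0 : q ≠ 0 := by
    rintro rfl
    simp at hq
  have hd : f.denom.eval z ≠ 0 := by
    obtain ⟨r, hr⟩ := RatFunc.denom_div_dvd p q
    rw [← hf] at hr
    intro h
    rw [hr, eval_mul, h, zero_mul] at hq
    exact hq rfl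
  have h1 : f.num * q = p * f.denom := by
    apply IsFractionRing.injective ℂ[X] (RatFunc ℂ)
    have := f.num_div_denom
    rw [hf, div_eq_div_iff (toK_ne_zero f.denom_ne_zero) (toK_ne_zero hq0), ← hf] at this
    simpa using this
  have h2 := congrArg (eval z) h1
  rw [eval_mul, eval_mul] at h2
  rw [RatFunc.eval, eval₂_id, eval₂_id, div_eq_div_iff hd hq, h2]

theorem hasDerivAt_exp_mul_div (c : ℂ) (p q : ℂ[X]) {z : ℂ} (hq : q.eval z ≠ 0) :
    HasDerivAt (fun w => Complex.exp (c * w ^ 2 / 2) * (p.eval w / q.eval w))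
      (Complex.exp (c * z ^ 2 / 2) *
        ((C c * X * p * q + (derivative p * q - p * derivative q)).eval z / (q ^ 2).eval z)) z := by
  have h1 : HasDerivAt (fun w : ℂ => c * w ^ 2 / 2) (c * (2 * z) / 2) z := by
    simpa using ((hasDerivAt_pow 2 z).const_mul c).div_const 2
  refine (h1.cexp.mul ((p.hasDerivAt z).div (q.hasDerivAt z) hq)).congr_deriv ?_
  simp only [eval_add, eval_sub, eval_mul, eval_pow, eval_C, eval_X, Pi.div_apply]
  field_simp

theorem deriv_logDeriv_eval (p : ℂ[X]) {z : ℂ} (hp : p.eval z ≠ 0) :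
    deriv (logDeriv fun w => p.eval w) z =
      (derivative (derivative p) * p - derivative p ^ 2).eval z / (p ^ 2).eval z := by
  have h1 : (logDeriv fun w => p.eval w) = fun w => (derivative p).eval w / p.eval w := by
    ext w
    rw [logDeriv_apply, Polynomial.deriv]
  have h2 := ((derivative p).hasDerivAt z).fun_div (p.hasDerivAt z) hp
  rw [h1, h2.deriv]
  simp only [eval_sub, eval_mul, eval_pow]
  ring

theorem isOpen_eval_ne_zero (p : ℂ[X]) : IsOpen {z : ℂ | p.eval z ≠ 0} :=
  isOpen_ne_fun p.continuous continuous_const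

theorem exists_eval_ne_zero {p : ℂ[X]} (hp : p ≠ 0) {s : Set ℂ} (hs : s.Infinite) :
    ∃ z ∈ s, p.eval z ≠ 0 := by
  by_contra! h
  exact hp (eq_zero_of_infinite_isRoot p (hs.mono h))

namespace MayaDiagram

theorem regularSet_eq (M : MayaDiagram) :
    M.regularSet = {z | M.pseudoWronskianPoly.eval z ≠ 0} := by
  rw [regularSet, pseudoWronskian_eq]

theorem isOpen_regularSet (M : MayaDiagram) : IsOpen M.regularSet := by
  rw [regularSet_eq]
  exact isOpen_eval_ne_zero _

theorem seed_eq (M : MayaDiagram) (m : ℤ) : M.seed m = fun z => Complex.exp (M.sign m * z ^ 2 / 2) *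
    ((M.flip m).pseudoWronskianPoly.eval z / M.pseudoWronskianPoly.eval z) := by
  ext z
  rw [seed, pseudoWronskian_eq, pseudoWronskian_eq]

theorem potential_eq (M : MayaDiagram) {z : ℂ} (hz : z ∈ M.regularSet) : M.potential z =
    z ^ 2 - 2 * ((derivative (derivative M.pseudoWronskianPoly) * M.pseudoWronskianPoly -
      derivative M.pseudoWronskianPoly ^ 2).eval z / (M.pseudoWronskianPoly ^ 2).eval z) +
      2 * (M.index : ℂ) := by
  rw [regularSet_eq] at hz
  rw [potential, pseudoWronskian_eq, deriv_logDeriv_eval _ hz]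

theorem sign_sq (M : MayaDiagram) (m : ℤ) : M.sign m ^ 2 = 1 := by
  unfold sign
  split_ifs <;> norm_num

/-- The bilinear form of the eigenvalue equation for the seed `exp (σ z² / 2) G / P`. -/
theorem hirota (M : MayaDiagram) (m : ℤ) (P G : ℂ[X]) (hP : P = M.pseudoWronskianPoly)
    (hG : G = (M.flip m).pseudoWronskianPoly) :
    derivative (derivative G) * P - 2 * derivative G * derivative P +
      G * derivative (derivative P) +
      2 * C (M.sign m) * X * (derivative G * P - G * derivative P) +
      C (M.sign m - 2 * M.index + (2 * m + 1)) * G * P = 0 := by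
  have hP0 : toK P ≠ 0 := toK_ne_zero (hP ▸ M.pseudoWronskianPoly_ne_zero)
  have hG0 : toK G ≠ 0 := toK_ne_zero (hG ▸ (M.flip m).pseudoWronskianPoly_ne_zero)
  have h := hermiteSystem.riccati_v M.seedSet m
  have hσ : toK (C (M.sign m)) ^ 2 = 1 := by
    rw [← map_pow, ← C_pow, sign_sq, C_1, map_one]
  rw [hermiteSystem_v_seedSet, hermiteSystem_u_seedSet, ← hP, ← hG, map_sub, map_add, map_add,
    Riccati.deriv_div _ hG0, Riccati.deriv_div _ hP0, RatFunc.ddX_algebraMap (C _ * X),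
    RatFunc.ddX_algebraMap (C _ * X), seedEigenvalue, algebraMap_const_eq] at h
  simp only [RatFunc.ddX_algebraMap, derivative_mul, derivative_C, derivative_X, zero_mul, zero_add,
    mul_one] at h
  apply IsFractionRing.injective ℂ[X] (RatFunc ℂ)
  field_simp at h
  apply mul_right_cancel₀ (mul_ne_zero hP0 hG0)
  simp only [map_add, map_sub, map_mul, map_pow, map_ofNat, map_one, map_zero, zero_mul,
    map_neg] at h ⊢
  linear_combination h - toK X ^ 2 * toK P ^ 2 * toK G ^ 2 * hσ

theorem hasDerivAt_seed (M : MayaDiagram) (m : ℤ) {z : ℂ} (hz : z ∈ M.regularSet) :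
    HasDerivAt (M.seed m) (Complex.exp (M.sign m * z ^ 2 / 2) *
      ((C (M.sign m) * X * (M.flip m).pseudoWronskianPoly * M.pseudoWronskianPoly +
        (derivative (M.flip m).pseudoWronskianPoly * M.pseudoWronskianPoly -
          (M.flip m).pseudoWronskianPoly * derivative M.pseudoWronskianPoly)).eval z /
        (M.pseudoWronskianPoly ^ 2).eval z)) z := by
  rw [regularSet_eq] at hz
  rw [seed_eq]
  exact hasDerivAt_exp_mul_div _ _ _ hz

theorem differentiableOn_seed (M : MayaDiagram) (m : ℤ) :
    DifferentiableOn ℂ (M.seed m) M.regularSet :=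
  fun _ hz => (M.hasDerivAt_seed m hz).differentiableAt.differentiableWithinAt

theorem seed_ne_zero_iff (M : MayaDiagram) (m : ℤ) {z : ℂ} (hz : z ∈ M.regularSet) :
    M.seed m z ≠ 0 ↔ (M.flip m).pseudoWronskianPoly.eval z ≠ 0 := by
  rw [regularSet_eq] at hz
  rw [seed_eq, mul_ne_zero_iff, div_ne_zero_iff]
  exact ⟨fun h => h.2.1, fun h => ⟨Complex.exp_ne_zero _, h, hz⟩⟩

theorem logDeriv_seed (M : MayaDiagram) (m : ℤ) {z : ℂ} (hz : z ∈ M.regularSet)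
    (h0 : M.seed m z ≠ 0) :
    logDeriv (M.seed m) z = (hermiteSystem.v M.seedSet m).eval (RingHom.id ℂ) z := by
  have hG := (M.seed_ne_zero_iff m hz).1 h0
  have hP : M.pseudoWronskianPoly.eval z ≠ 0 := by rwa [regularSet_eq] at hz
  have hv : hermiteSystem.v M.seedSet m =
      toK (C (M.sign m) * X * (M.flip m).pseudoWronskianPoly * M.pseudoWronskianPoly +
        (derivative (M.flip m).pseudoWronskianPoly * M.pseudoWronskianPoly -
          (M.flip m).pseudoWronskianPoly * derivative M.pseudoWronskianPoly)) /
        toK ((M.flip m).pseudoWronskianPoly * M.pseudoWronskianPoly) := by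
    have h1 := toK_ne_zero (M.flip m).pseudoWronskianPoly_ne_zero
    have h2 := toK_ne_zero M.pseudoWronskianPoly_ne_zero
    rw [hermiteSystem_v_seedSet, RatFunc.ddX_algebraMap, RatFunc.ddX_algebraMap]
    simp only [map_add, map_sub, map_mul]
    field_simp
    ring
  have he := Complex.exp_ne_zero (M.sign m * z ^ 2 / 2)
  rw [hv, ratFunc_eval_div _ _ (by rw [eval_mul]; exact mul_ne_zero hG hP), logDeriv_apply,
    (M.hasDerivAt_seed m hz).deriv, seed_eq]
  simp only [eval_mul, eval_pow]
  field_simp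

theorem isQuasiRationalOn_seed (M : MayaDiagram) (m : ℤ) :
    IsQuasiRationalOn (M.seed m) M.regularSet := by
  refine ⟨M.differentiableOn_seed m, ?_, hermiteSystem.v M.seedSet m,
    fun z hz h0 => M.logDeriv_seed m hz h0⟩
  obtain ⟨z, -, hz⟩ := exists_eval_ne_zero (mul_ne_zero M.pseudoWronskianPoly_ne_zero
    (M.flip m).pseudoWronskianPoly_ne_zero) Set.infinite_univ
  rw [eval_mul, mul_ne_zero_iff] at hz
  have hz' : z ∈ M.regularSet := by
    rw [regularSet_eq]
    exact hz.1
  exact ⟨z, hz', (M.seed_ne_zero_iff m hz').2 hz.2⟩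

theorem solvesSchrodingerOn_seed (M : MayaDiagram) (m : ℤ) :
    SolvesSchrodingerOn M.potential (M.seed m) (2 * (m : ℂ) + 1) M.regularSet := by
  intro z hz
  have hσ := M.sign_sq m
  have hH := congrArg (eval z) (M.hirota m _ _ rfl rfl)
  have hev := Filter.eventually_of_mem (M.isOpen_regularSet.mem_nhds hz)
    fun w hw => (M.hasDerivAt_seed m hw).deriv
  have hP : M.pseudoWronskianPoly.eval z ≠ 0 := by rwa [regularSet_eq] at hz
  have hP2 : (M.pseudoWronskianPoly ^ 2).eval z ≠ 0 := by
    rw [eval_pow]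
    exact pow_ne_zero 2 hP
  rw [M.potential_eq hz, iteratedDeriv_succ, iteratedDeriv_one, Filter.EventuallyEq.deriv_eq hev,
    (hasDerivAt_exp_mul_div _ _ _ hP2).deriv, seed_eq]
  generalize M.pseudoWronskianPoly = P at *
  generalize (M.flip m).pseudoWronskianPoly = G at *
  simp only [derivative_add, derivative_sub, derivative_mul, derivative_C, derivative_X,
    derivative_pow, eval_add, eval_sub, eval_mul, eval_pow, eval_C, eval_X, eval_zero, eval_ofNat,
    zero_mul, zero_add, mul_one,
    Nat.cast_ofNat, Nat.reduceSub, pow_one] at hH ⊢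
  field_simp
  linear_combination (-eval z P) * hH - z ^ 2 * eval z G * eval z P ^ 2 * hσ

end MayaDiagram

/-! ### Quasi-rational eigenfunctions -/

namespace MayaDiagram

/-- The logarithmic derivative of a quasi-rational eigenfunction solves the Riccati equation in
the field of rational functions, as it does so at infinitely many points. -/
theorem riccati_of_quasiRational (M : MayaDiagram) {Ω : Set ℂ} (hΩ : IsOpen Ω)
    (hsub : Ω ⊆ M.regularSet) {f : ℂ → ℂ} {E : ℂ} (hf : DifferentiableOn ℂ f Ω)
    {z₀ : ℂ} (hz₀ : z₀ ∈ Ω) (hfz₀ : f z₀ ≠ 0) {R : RatFunc ℂ}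
    (hR : ∀ z ∈ Ω, f z ≠ 0 → logDeriv f z = R.eval (RingHom.id ℂ) z)
    (hE : SolvesSchrodingerOn M.potential f E Ω) :
    DK R + R ^ 2 = toK (X ^ 2) - 2 * DK (hermiteSystem.u M.seedSet) -
      algebraMap ℂ (RatFunc ℂ) E := by
  obtain ⟨A, hA⟩ : ∃ A, A = R.num := ⟨_, rfl⟩
  obtain ⟨B, hB⟩ : ∃ B, B = R.denom := ⟨_, rfl⟩
  have hB0 : B ≠ 0 := by
    rw [hB]
    exact R.denom_ne_zero
  have hR' : R = toK A / toK B := by rw [hA, hB, R.num_div_denom]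
  have hP0 := M.pseudoWronskianPoly_ne_zero
  obtain ⟨P, hP⟩ : ∃ P, P = M.pseudoWronskianPoly := ⟨_, rfl⟩
  rw [← hP] at hP0
  have hopen : IsOpen (Ω ∩ f ⁻¹' {0}ᶜ) :=
    hf.continuousOn.isOpen_inter_preimage hΩ isOpen_compl_singleton
  have hderiv : ∀ z ∈ Ω, f z ≠ 0 → B.eval z ≠ 0 →
      HasDerivAt f (A.eval z / B.eval z * f z) z := by
    intro z hz hfz hBz
    have h1 := hR z hz hfz
    rw [hR', ratFunc_eval_div _ _ hBz, logDeriv_apply, div_eq_iff hfz] at h1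
    rw [← h1]
    exact (hf.differentiableAt (hΩ.mem_nhds hz)).hasDerivAt
  have key : (derivative A * B - A * derivative B + A ^ 2) * P ^ 2 =
      ((X ^ 2 + C (2 * M.index - E)) * P ^ 2 -
        2 * (derivative (derivative P) * P - derivative P ^ 2)) * B ^ 2 := by
    have hinf : ((Ω ∩ f ⁻¹' {0}ᶜ) ∩ {z | B.eval z ≠ 0}).Infinite := by
      have h1 : (Ω ∩ f ⁻¹' {0}ᶜ).Infinite :=
        infinite_of_mem_nhds z₀ (hopen.mem_nhds ⟨hz₀, hfz₀⟩)
      intro hfin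
      refine h1 ((hfin.union (finite_setOfPred_isRoot hB0)).subset fun z hz => ?_)
      by_cases h : B.eval z = 0
      · exact Or.inr h
      · exact Or.inl ⟨hz, h⟩
    refine eq_of_infinite_eval_eq _ _ (hinf.mono ?_)
    rintro z ⟨⟨hz, hfz⟩, hBz⟩
    have hfz' : f z ≠ 0 := hfz
    have hBz' : B.eval z ≠ 0 := hBz
    have hev : deriv f =ᶠ[nhds z] fun w => A.eval w / B.eval w * f w := by
      refine Filter.eventually_of_mem ((hopen.inter (isOpen_eval_ne_zero B)).mem_nhds
        ⟨⟨hz, hfz⟩, hBz⟩) fun w hw => ?_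
      exact (hderiv w hw.1.1 hw.1.2 hw.2).deriv
    have h2 : HasDerivAt (fun w => A.eval w / B.eval w * f w) _ z :=
      ((A.hasDerivAt z).fun_div (B.hasDerivAt z) hBz').mul (hderiv z hz hfz' hBz')
    have hS := hE z hz
    have hPz : P.eval z ≠ 0 := by
      have := hsub hz
      rw [regularSet_eq, ← hP] at this
      exact this
    rw [M.potential_eq (hsub hz), ← hP, iteratedDeriv_succ, iteratedDeriv_one, hev.deriv_eq,
      h2.deriv] at hS
    change eval z _ = eval z _
    simp only [eval_add, eval_sub, eval_mul, eval_pow, eval_C, eval_X, eval_ofNat] at hS ⊢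
    field_simp at hS
    linear_combination -hS
  have hBK := toK_ne_zero hB0
  have hPK := toK_ne_zero hP0
  rw [hermiteSystem_u_seedSet, ← hP, hR', RatFunc.ddX_div _ _ hB0, map_add,
    Riccati.deriv_div _ hPK, RatFunc.ddX_algebraMap, RatFunc.ddX_algebraMap,
    RatFunc.ddX_algebraMap, algebraMap_const_eq]
  have hkey := congrArg toK key
  simp only [derivative_mul, derivative_C, derivative_X, map_add, map_sub, map_mul, map_pow,
    map_ofNat, map_neg, map_zero, mul_one] at hkey ⊢
  field_simp
  linear_combination hkey

/-- Every quasi-rational eigenfunction is a multiple of a seed. -/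
theorem exists_seed_of_quasiRational (M : MayaDiagram) {Ω : Set ℂ} (hΩ : IsOpen Ω)
    (hconn : IsConnected Ω) (hsub : Ω ⊆ M.regularSet) {f : ℂ → ℂ} {E : ℂ}
    (hf : IsQuasiRationalOn f Ω) (hE : SolvesSchrodingerOn M.potential f E Ω) :
    ∃ m : ℤ, E = 2 * (m : ℂ) + 1 ∧ ∃ c : ℂ, c ≠ 0 ∧ ∀ z ∈ Ω, f z = c * M.seed m z := by
  obtain ⟨hd, ⟨z₀, hz₀, hfz₀⟩, R, hR⟩ := hf
  obtain ⟨m, hm, hRm⟩ := hermiteSystem_riccatiComplete M.seedSet R E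
    (M.riccati_of_quasiRational hΩ hsub hd hz₀ hfz₀ hR hE)
  refine ⟨m, (algebraMap ℂ (RatFunc ℂ)).injective hm, ?_⟩
  have hopen : IsOpen (Ω ∩ f ⁻¹' {0}ᶜ) :=
    hd.continuousOn.isOpen_inter_preimage hΩ isOpen_compl_singleton
  -- near a point where neither function vanishes, they have the same logarithmic derivative
  obtain ⟨z₁, hz₁, hGz₁⟩ := exists_eval_ne_zero (M.flip m).pseudoWronskianPoly_ne_zero
    (infinite_of_mem_nhds z₀ (hopen.mem_nhds ⟨hz₀, hfz₀⟩))
  obtain ⟨r, hr, hball⟩ := Metric.isOpen_iff.1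
    (hopen.inter (isOpen_eval_ne_zero (M.flip m).pseudoWronskianPoly)) z₁ ⟨hz₁, hGz₁⟩
  have hbΩ : Metric.ball z₁ r ⊆ Ω := fun z hz => (hball hz).1.1
  have hbf : ∀ z ∈ Metric.ball z₁ r, f z ≠ 0 := fun z hz => (hball hz).1.2
  have hbs : ∀ z ∈ Metric.ball z₁ r, M.seed m z ≠ 0 := fun z hz =>
    (M.seed_ne_zero_iff m (hsub (hbΩ hz))).2 (hball hz).2
  have hds : DifferentiableOn ℂ (M.seed m) Ω := (M.differentiableOn_seed m).mono hsub
  obtain ⟨c, hc, heq⟩ := (logDeriv_eqOn_iff (hd.mono hbΩ) (hds.mono hbΩ) Metric.isOpen_ball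
    (convex_ball z₁ r).isPreconnected hbs hbf).1 fun z hz => by
      rw [hR z (hbΩ hz) (hbf z hz), hRm, M.logDeriv_seed m (hsub (hbΩ hz)) (hbs z hz)]
  refine ⟨c, hc, ?_⟩
  exact (hd.analyticOnNhd hΩ).eqOn_of_preconnected_of_eventuallyEq
    ((hds.const_mul c).analyticOnNhd hΩ) hconn.isPreconnected (hbΩ (Metric.mem_ball_self hr))
    (Filter.eventuallyEq_of_mem (Metric.ball_mem_nhds z₁ hr) heq)

end MayaDiagram

theorem mainTheorem4 (M : MayaDiagram) :
    (∀ m : ℤ,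
      IsQuasiRationalOn (M.seed m) M.regularSet ∧
        SolvesSchrodingerOn M.potential (M.seed m) (2 * (m : ℂ) + 1) M.regularSet) ∧
    (∀ (Ω : Set ℂ), IsOpen Ω → IsConnected Ω → Ω ⊆ M.regularSet →
      ∀ (f : ℂ → ℂ) (E : ℂ),
        IsQuasiRationalOn f Ω → SolvesSchrodingerOn M.potential f E Ω →
          ∃ m : ℤ, E = 2 * (m : ℂ) + 1 ∧
            ∃ c : ℂ, c ≠ 0 ∧ ∀ z ∈ Ω, f z = c * M.seed m z) :=
  ⟨fun m => ⟨M.isQuasiRationalOn_seed m, M.solvesSchrodingerOn_seed m⟩,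
    fun _ hΩ hconn hsub _ _ hf hE => M.exists_seed_of_quasiRational hΩ hconn hsub hf hE⟩
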